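/- Let \(k(z)=\sum_{n\ge 0}a_nz^n\) be an analytic function without zeros on the unit disc \(\mathbb D\) with \(a_0=1\), \(a_n>0\) for all \(n\), \(0<\inf_n \frac{a_n}{a_{n+1}}\le\sup_n\frac{a_n}{a_{n+1}}<\infty\), and such that \(\lim_{n}\frac{a_n}{a_{n+1}}\) exists; write \(1/k=\sum_n c_nz^n\) near \(0\). For a Hilbert space \(\mathscr E\), let \(H_K(\mathscr E)\) be the \(\mathscr E\)-valued functional Hilbert space on the unit ball \(\mathbb B_d\subset\mathbb C^d\) with reproducing kernel \(K(z,w)1_{\mathscr E}\), \(K(z,w)=k(\langle z,w\rangle)\), with multiplication tuple \(M_z=(M_{z_1},\dots,M_{z_d})\) and row operator \(M_z:H_K(\mathscr E)^d\to H_K(\mathscr E)\). Write \(\gamma_\alpha=|\alpha|!/\alpha!\). Let \(T=(T_1,\dots,T_d)\) be a commuting tuple of bounded operators on a complex Hilbert space \(H\), and let \(\sigma_T(X)=\sum_iT_iXT_i^*\). Suppose that \(T\) is a pure \(K\)-contraction, i.e. \(\frac1K(T)=\mathrm{SOT}\text{-}\sum_{n}c_n\sigma_T^n(1_H)\) exists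 and is positive, and \(\mathrm{SOT}\text{-}\lim_{N\to\infty}\bigl(1_H-\sum_{n=0}^Na_n\sigma_T^n(\tfrac1K(T))\bigr)=0\). Let \(C=\frac1K(T)^{1/2}\), \(\mathscr D=\overline{\operatorname{Im}C}\), and let \(j:H\to H_K(\mathscr D)\), \(jh=\sum_{\alpha}a_{|\alpha|}\gamma_\alpha (CT^{*\alpha}h)z^\alpha\), be the canonical dilation, an isometry. Let \(\Delta\) be the bounded operator on \(H_K(\mathscr D)\) with \(\Delta\sum_\alpha f_\alpha z^\alpha=\sum_\alpha\frac{a_{|\alpha|+1}}{a_{|\alpha|}}f_\alpha z^\alpha\), let \(\Delta_T=j^*\Delta j\), let \(\tilde H\) be the space \(H\) with the scalar product \((x,y)=\langle\Delta_Tx,y\rangle\), and \(I_T:H\to\tilde H\), \(x\mapsto x\) (an invertible bounded operator). Let \(\tilde T:\tilde H^d\to H\) be the row operator with components \(T_iI_T^*\) (a contraction), \(D_{\tilde T}=(1-\tilde T^*\tilde T)^{1/2}\), \(\mathscr D_{\tilde T}=\overline{D_{\tilde T}\tilde H^d}\), and \[\tilde{\mathscr D}=\{y\in\mathscr D_{\tilde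 T}:\ (\oplus jI_T^{-1})D_{\tilde T}y\in M_z^*H_K(\mathscr D)\}\] with the norm of \(\tilde H^d\). For \(z\in\mathbb B_d\), let \(Z:H^d\to H\), \((h_i)\mapsto\sum_iz_ih_i\), let \(ZT^*=\sum_iz_iT_i^*\), and let \(F(ZT^*)=\sum_{n\ge0}a_{n+1}(ZT^*)^n\). Finally, let \(M=(\operatorname{Im}j)^\perp\subset H_K(\mathscr D)\) and \(W(M)=M\ominus\sum_{i=1}^dM_{z_i}M\). Then: (a) \(jT_i^*=M_{z_i}^*j\) for \(i=1,\dots,d\) (so that \(M\) is \(M_z\)-invariant), \(\tilde{\mathscr D}\) is closed in \(\tilde H^d\), and the series \(F(ZT^*)\) is summable in operator norm for each \(z\in\mathbb B_d\). (b) For \(z\in\mathbb B_d\), \(W_T(z)x=-\tilde Tx+CF(ZT^*)Z(\oplus I_T^{-1})D_{\tilde T}x\) defines a bounded operator \(W_T(z)\in L(\tilde{\mathscr D},\mathscr D)\). (c) For each \(x\in\tilde{\mathscr D}\), the function \(W_Tx=W_T(\cdot)x\) belongs to \(H_K(\mathscr D)\) and \(\|W_Tx\|=\|x\|\). (d) \(W(M)=\{W_Tx:\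 x\in\tilde{\mathscr D}\}\). (e) \(W_T\) is a \(K\)-inner function: \(W_T:\mathbb B_d\to L(\tilde{\mathscr D},\mathscr D)\) is analytic, \(\tilde{\mathscr D}\to H_K(\mathscr D)\), \(x\mapsto W_Tx\), is a well-defined linear isometry, and \(W_T(\tilde{\mathscr D})\perp M_z^\alpha W_T(\tilde{\mathscr D})\) for all \(\alpha\in\mathbb N^d\setminus\{0\}\). -/

import Mathlib

open Filter Topology

/-- The coefficient sequence of an admissible function `k(z) = ∑ aₙ zⁿ` on the unit disc. -/
structure KernelSeq where
  a : ℕ → ℝ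
  a_zero : a 0 = 1
  a_pos : ∀ n, 0 < a n
  summable_disc : ∀ z : ℂ, ‖z‖ < 1 → Summable fun n => (a n : ℂ) * z ^ n
  ne_zero_disc : ∀ z : ℂ, ‖z‖ < 1 → ∑' n, (a n : ℂ) * z ^ n ≠ 0
  ratio_inf_pos : 0 < ⨅ n, a n / a (n + 1)
  ratio_bddAbove : BddAbove (Set.range fun n => a n / a (n + 1))
  ratio_tendsto : ∃ r : ℝ, Tendsto (fun n => a n / a (n + 1)) atTop (𝓝 r)

namespace KernelSeq

variable (κ : KernelSeq)

/-- The function `k` on the unit disc. -/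
noncomputable def k (z : ℂ) : ℂ := ∑' n, (κ.a n : ℂ) * z ^ n

/-- The Taylor coefficients `cₙ` at the origin of the reciprocal `1 / k`. -/
noncomputable def c (n : ℕ) : ℂ := iteratedDeriv n (fun z => (κ.k z)⁻¹) 0 / (n.factorial : ℂ)

/-- The weight `a_{|α|} γ_α` with `γ_α = |α|! / α!`. -/
noncomputable def wt {d : ℕ} (α : Fin d → ℕ) : ℝ :=
  κ.a (∑ i, α i) * (Nat.multinomial Finset.univ α : ℝ)

theorem wt_pos {d : ℕ} (α : Fin d → ℕ) : 0 < κ.wt α :=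
  mul_pos (κ.a_pos _) (by exact_mod_cast Nat.multinomial_pos _ _)

theorem ratio_le (n : ℕ) : κ.a n / κ.a (n + 1) ≤ ⨆ m, κ.a m / κ.a (m + 1) :=
  le_ciSup κ.ratio_bddAbove n

theorem ratio_inv_le (n : ℕ) : κ.a (n + 1) / κ.a n ≤ (⨅ m, κ.a m / κ.a (m + 1))⁻¹ := by
  have h : (⨅ m, κ.a m / κ.a (m + 1)) ≤ κ.a n / κ.a (n + 1) :=
    ciInf_le ⟨0, by rintro _ ⟨m, rfl⟩; exact (div_pos (κ.a_pos _) (κ.a_pos _)).le⟩ n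
  rw [← inv_div]
  exact inv_anti₀ κ.ratio_inf_pos h

end KernelSeq

section Degree

variable {d : ℕ}

theorem summable_of_degree {f : (Fin d → ℕ) → ℝ} (hf : ∀ α, 0 ≤ f α)
    (h : Summable fun n => ∑ α ∈ Finset.piAntidiag Finset.univ n, f α) : Summable f := by
  refine summable_of_sum_le hf (c := ∑' n, ∑ α ∈ Finset.piAntidiag Finset.univ n, f α) fun s => ?_
  have hs : s ⊆ (s.image fun α => ∑ i, α i).biUnion
      fun n => Finset.piAntidiag Finset.univ n := by
    intro α hα
    simp only [Finset.mem_biUnion, Finset.mem_image, Finset.mem_piAntidiag]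
    exact ⟨_, ⟨α, hα, rfl⟩, rfl, by simp⟩
  refine (Finset.sum_le_sum_of_subset_of_nonneg hs fun α _ _ => hf α).trans ?_
  rw [Finset.sum_biUnion]
  · exact h.sum_le_tsum _ fun n _ => Finset.sum_nonneg fun α _ => hf α
  · intro m _ n _ hmn
    refine Finset.disjoint_left.2 fun α h1 h2 => hmn ?_
    rw [← (Finset.mem_piAntidiag.1 h1).1, ← (Finset.mem_piAntidiag.1 h2).1]

theorem hasSum_degree {E : Type*} [NormedAddCommGroup E]
    {f : (Fin d → ℕ) → E} {s : E} (h : HasSum f s) :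
    HasSum (fun n => ∑ α ∈ Finset.piAntidiag Finset.univ n, f α) s := by
  classical
  have h1 : HasSum (f ∘ (Equiv.sigmaFiberEquiv fun α : Fin d → ℕ => ∑ i, α i)) s :=
    (Equiv.hasSum_iff _).2 h
  refine h1.sigma fun n => ?_
  have h2 := Finset.hasSum (Finset.piAntidiag (Finset.univ : Finset (Fin d)) n) f
  let e : {α : Fin d → ℕ // ∑ i, α i = n} ≃
      {α // α ∈ Finset.piAntidiag (Finset.univ : Finset (Fin d)) n} :=
    Equiv.subtypeEquivRight fun α => by simp
  exact (Equiv.hasSum_iff e).2 h2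

theorem KernelSeq.summable_wt (κ : KernelSeq) {u : Fin d → ℝ} (hu : ∀ i, 0 ≤ u i)
    (h1 : ∑ i, u i < 1) : Summable fun α : Fin d → ℕ => κ.wt α * ∏ i, u i ^ α i := by
  refine summable_of_degree
    (fun α => mul_nonneg (κ.wt_pos α).le (Finset.prod_nonneg fun i _ => pow_nonneg (hu i) _)) ?_
  have h2 : 0 ≤ ∑ i, u i := Finset.sum_nonneg fun i _ => hu i
  have h3 := (κ.summable_disc ((∑ i, u i : ℝ) : ℂ)
    (by rw [Complex.norm_real, Real.norm_of_nonneg h2]; exact h1))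
  have h4 : Summable fun n => κ.a n * (∑ i, u i) ^ n := by exact_mod_cast h3
  refine h4.congr fun n => ?_
  rw [Finset.sum_pow_eq_sum_piAntidiag, Finset.mul_sum]
  refine Finset.sum_congr rfl fun α hα => ?_
  have : ∑ i, α i = n := by simpa using hα
  rw [KernelSeq.wt, this, mul_assoc]

theorem KernelSeq.hasSum_wt (κ : KernelSeq) {u : Fin d → ℂ} (h1 : ∑ i, ‖u i‖ < 1) :
    HasSum (fun α : Fin d → ℕ => (κ.wt α : ℂ) * ∏ i, u i ^ α i) (κ.k (∑ i, u i)) := by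
  have h2 : Summable (fun α : Fin d → ℕ => (κ.wt α : ℂ) * ∏ i, u i ^ α i) := by
    refine Summable.of_norm ?_
    refine (κ.summable_wt (fun i => norm_nonneg (u i)) h1).congr fun α => ?_
    simp [abs_of_pos (κ.wt_pos α)]
  have h3 := hasSum_degree h2.hasSum
  have h4 : κ.k (∑ i, u i) = ∑' α : Fin d → ℕ, (κ.wt α : ℂ) * ∏ i, u i ^ α i := by
    rw [← h3.tsum_eq]
    refine tsum_congr fun n => ?_
    rw [Finset.sum_pow_eq_sum_piAntidiag, Finset.mul_sum]
    refine Finset.sum_congr rfl fun α hα => ?_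
    have : ∑ i, α i = n := by simpa using hα
    rw [KernelSeq.wt, this]; push_cast; ring
  rw [h4]; exact h2.hasSum

end Degree

/-- Weighted composition on `ℓ²`: `(b_α) ↦ (c_α b_{e α})`. -/
noncomputable def wcomp {ι : Type*} {E : Type*} [NormedAddCommGroup E] [InnerProductSpace ℂ E]
    (e : ι → ι) (he : Function.Injective e) (c : ι → ℝ) (R : ℝ) (hc : ∀ α, |c α| ≤ R) :
    lp (fun _ : ι => E) 2 →L[ℂ] lp (fun _ : ι => E) 2 :=
  have key (b : lp (fun _ : ι => E) 2) : Summable (fun α => ‖(c α : ℂ) • b (e α)‖ ^ 2) ∧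
      ∑' α, ‖(c α : ℂ) • b (e α)‖ ^ 2 ≤ (|R| * ‖b‖) ^ 2 := by
    have h0 : HasSum (fun α => ‖b α‖ ^ 2) (‖b‖ ^ 2) := by
      have := lp.hasSum_norm (p := 2) (by norm_num) b
      simpa using this
    have h1 : Summable (fun α => ‖b (e α)‖ ^ 2) := h0.summable.comp_injective he
    have h2 : ∑' α, ‖b (e α)‖ ^ 2 ≤ ‖b‖ ^ 2 := by
      rw [← h0.tsum_eq]
      exact tsum_comp_le_tsum_of_inj h0.summable (fun _ => by positivity) he
    have h3 (α : ι) : ‖(c α : ℂ) • b (e α)‖ ^ 2 ≤ |R| ^ 2 * ‖b (e α)‖ ^ 2 := by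
      rw [norm_smul, mul_pow, Complex.norm_real, Real.norm_eq_abs]
      exact mul_le_mul_of_nonneg_right
        (pow_le_pow_left₀ (abs_nonneg _) ((hc α).trans (le_abs_self R)) 2) (sq_nonneg _)
    have h4 := Summable.of_nonneg_of_le (fun _ => by positivity) h3 (h1.mul_left _)
    refine ⟨h4, (h4.tsum_le_tsum h3 (h1.mul_left _)).trans ?_⟩
    rw [tsum_mul_left, mul_pow]
    gcongr
  LinearMap.mkContinuous
    { toFun := fun b => ⟨fun α => (c α : ℂ) • b (e α), memℓp_gen (by simpa using (key b).1)⟩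
      map_add' := fun b b' => Subtype.ext (funext fun α => smul_add _ _ _)
      map_smul' := fun t b => Subtype.ext (funext fun α => smul_comm _ _ _) }
    |R| fun b => by
      refine lp.norm_le_of_tsum_le (p := 2) (by norm_num) (by positivity) ?_
      simpa using (key b).2

@[simp]
theorem wcomp_apply {ι : Type*} {E : Type*} [NormedAddCommGroup E] [InnerProductSpace ℂ E]
    (e : ι → ι) (he : Function.Injective e) (c : ι → ℝ) (R : ℝ) (hc : ∀ α, |c α| ≤ R)
    (b : lp (fun _ : ι => E) 2) (α : ι) : wcomp e he c R hc b α = (c α : ℂ) • b (e α) := rfl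

/-- The open Euclidean unit ball of `ℂᵈ`. -/
abbrev UBall (d : ℕ) : Set (EuclideanSpace ℂ (Fin d)) := Metric.ball 0 1

/-- The space `H_K(E)` of all `f = ∑ f_α z^α` with
`‖f‖² = ∑ ‖f_α‖² / (a_{|α|} γ_α) < ∞`. An element is stored through its coordinates
`b_α = f_α / √(a_{|α|} γ_α)`; see `HK.coeff`, the `RKHS` instance (values of `f` on the ball)
and `HK.kernel_eq` (the reproducing kernel is `K(z, w) 1_E`). -/
def HK (_κ : KernelSeq) (d : ℕ) (E : Type*) [NormedAddCommGroup E] : Type _ :=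
  lp (fun _ : Fin d → ℕ => E) 2

namespace HK

variable {κ : KernelSeq} {d : ℕ} {E : Type*} [NormedAddCommGroup E] [InnerProductSpace ℂ E]

noncomputable instance : NormedAddCommGroup (HK κ d E) :=
  inferInstanceAs (NormedAddCommGroup (lp (fun _ : Fin d → ℕ => E) 2))

noncomputable instance : InnerProductSpace ℂ (HK κ d E) :=
  inferInstanceAs (InnerProductSpace ℂ (lp (fun _ : Fin d → ℕ => E) 2))

noncomputable instance [CompleteSpace E] : CompleteSpace (HK κ d E) :=
  inferInstanceAs (CompleteSpace (lp (fun _ : Fin d → ℕ => E) 2))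

/-- The isometric identification with the coordinate sequences. -/
noncomputable def seq : HK κ d E ≃ₗᵢ[ℂ] lp (fun _ : Fin d → ℕ => E) 2 :=
  LinearIsometryEquiv.refl ℂ _

/-- The Taylor coefficient `f_α`. -/
noncomputable def coeff (f : HK κ d E) (α : Fin d → ℕ) : E :=
  ((Real.sqrt (κ.wt α) : ℝ) : ℂ) • (seq f) α

theorem norm_sq_eq_tsum (f : HK κ d E) :
    HasSum (fun α => ‖coeff f α‖ ^ 2 / κ.wt α) (‖f‖ ^ 2) := by
  have h0 : HasSum (fun α => ‖seq f α‖ ^ 2) (‖f‖ ^ 2) := by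
    have := lp.hasSum_norm (p := 2) (by norm_num) (seq f)
    rw [LinearIsometryEquiv.norm_map] at this
    simpa using this
  refine h0.congr_fun ?_
  intro α
  have := κ.wt_pos α
  rw [coeff, norm_smul, Complex.norm_real, mul_pow, Real.norm_eq_abs, sq_abs,
    Real.sq_sqrt this.le]
  field_simp

theorem summable_wt_ball (κ : KernelSeq) (z : UBall d) :
    Summable fun α : Fin d → ℕ => (Real.sqrt (κ.wt α) * ∏ i, ‖z.1 i‖ ^ α i) ^ 2 := by
  have hz : ∑ i, ‖z.1 i‖ ^ 2 < 1 := by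
    rw [← EuclideanSpace.norm_sq_eq]
    have := mem_ball_zero_iff.1 z.2
    nlinarith [norm_nonneg z.1]
  refine (κ.summable_wt (fun i => sq_nonneg ‖z.1 i‖) hz).congr fun α => ?_
  rw [mul_pow, Real.sq_sqrt (κ.wt_pos α).le, ← Finset.prod_pow]
  congr 1
  exact Finset.prod_congr rfl fun i _ => by ring

theorem eval_bound (z : UBall d) (f : HK κ d E) :
    Summable (fun α : Fin d → ℕ => ‖(∏ i, z.1 i ^ α i) • coeff f α‖) ∧
    ∑' α : Fin d → ℕ, ‖(∏ i, z.1 i ^ α i) • coeff f α‖ ≤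
      Real.sqrt (∑' α : Fin d → ℕ, (Real.sqrt (κ.wt α) * ∏ i, ‖z.1 i‖ ^ α i) ^ 2) * ‖f‖ := by
  have h0 : HasSum (fun α => ‖seq f α‖ ^ 2) (‖f‖ ^ 2) := by
    have := lp.hasSum_norm (p := 2) (by norm_num) (seq f)
    rw [LinearIsometryEquiv.norm_map] at this
    simpa using this
  have h1 := summable_wt_ball κ z
  have h2 := Real.summable_and_inner_le_Lp_mul_Lq_tsum_of_nonneg (p := 2) (q := 2)
    (by rw [Real.holderConjugate_iff]; norm_num)
    (f := fun α : Fin d → ℕ => Real.sqrt (κ.wt α) * ∏ i, ‖z.1 i‖ ^ α i)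
    (g := fun α => ‖seq f α‖)
    (fun α => by positivity) (fun α => by positivity) (by simpa using h1) (by simpa using h0.summable)
  have h3 (α : Fin d → ℕ) : ‖(∏ i, z.1 i ^ α i) • coeff f α‖ =
      (Real.sqrt (κ.wt α) * ∏ i, ‖z.1 i‖ ^ α i) * ‖seq f α‖ := by
    rw [coeff, norm_smul, norm_smul, Complex.norm_real, Real.norm_of_nonneg (Real.sqrt_nonneg _)]
    simp only [norm_prod, norm_pow]
    ring
  simp only [h3]
  refine ⟨h2.1, h2.2.trans (le_of_eq ?_)⟩
  simp only [Real.rpow_two, ← Real.sqrt_eq_rpow, h0.tsum_eq, Real.sqrt_sq (norm_nonneg f)]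

theorem coeff_add (f g : HK κ d E) (α : Fin d → ℕ) :
    coeff (f + g) α = coeff f α + coeff g α := by simp [coeff]

theorem coeff_smul (t : ℂ) (f : HK κ d E) (α : Fin d → ℕ) :
    coeff (t • f) α = t • coeff f α := by
  simp only [coeff, map_smul, lp.coeFn_smul, Pi.smul_apply]
  rw [smul_comm]

variable [CompleteSpace E]

set_option linter.unusedSectionVars false

/-- Evaluation of `f = ∑ f_α z^α` at a point of the ball. -/
noncomputable def evalCLM (κ : KernelSeq) (E : Type*) [NormedAddCommGroup E]
    [InnerProductSpace ℂ E] [CompleteSpace E] (z : UBall d) : HK κ d E →L[ℂ] E :=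
  LinearMap.mkContinuous
    { toFun := fun f => ∑' α : Fin d → ℕ, (∏ i, z.1 i ^ α i) • coeff f α
      map_add' := fun f g => by
        rw [← (eval_bound z f).1.of_norm.tsum_add (eval_bound z g).1.of_norm]
        exact tsum_congr fun α => by rw [coeff_add, smul_add]
      map_smul' := fun t f => by
        rw [RingHom.id_apply, ← (eval_bound z f).1.of_norm.tsum_const_smul]
        exact tsum_congr fun α => by rw [coeff_smul, smul_comm] }
    (Real.sqrt (∑' α : Fin d → ℕ, (Real.sqrt (κ.wt α) * ∏ i, ‖z.1 i‖ ^ α i) ^ 2))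
    fun f => (norm_tsum_le_tsum_norm (eval_bound z f).1).trans (eval_bound z f).2

theorem hasSum_eval (z : UBall d) (f : HK κ d E) :
    HasSum (fun α : Fin d → ℕ => (∏ i, z.1 i ^ α i) • coeff f α) (evalCLM κ E z f) :=
  (eval_bound z f).1.of_norm.hasSum

theorem coeff_eq_zero_of_hasSum {p : ℕ → ℂ}
    (h : ∀ t : ℂ, ‖t‖ < 1 → HasSum (fun n => t ^ n * p n) 0) : p = 0 := by
  have h1 : HasFPowerSeriesAt (0 : ℂ → ℂ) (FormalMultilinearSeries.ofScalars ℂ p) 0 := by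
    rw [hasFPowerSeriesAt_iff]
    filter_upwards [Metric.ball_mem_nhds (0 : ℂ) one_pos] with t ht
    simpa using h t (mem_ball_zero_iff.1 ht)
  exact (FormalMultilinearSeries.ofScalars_series_eq_zero ℂ).1 h1.eq_zero

theorem mvcoeff_eq_zero {q : (Fin d → ℕ) → ℂ}
    (h : ∀ z : UBall d, HasSum (fun α : Fin d → ℕ => (∏ i, z.1 i ^ α i) * q α) 0) (α : Fin d → ℕ) :
    q α = 0 := by
  classical
  have h1 (z : UBall d) (n : ℕ) :
      ∑ β ∈ Finset.piAntidiag Finset.univ n, (∏ i, z.1 i ^ β i) * q β = 0 := by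
    have h2 := coeff_eq_zero_of_hasSum
      (p := fun n => ∑ β ∈ Finset.piAntidiag Finset.univ n, (∏ i, z.1 i ^ β i) * q β) ?_
    · exact congrFun h2 n
    · intro t ht
      have hz := mem_ball_zero_iff.1 z.2
      have h3 := hasSum_degree (h ⟨t • z.1, by
        rw [mem_ball_zero_iff, norm_smul]; nlinarith [norm_nonneg t, norm_nonneg z.1]⟩)
      refine h3.congr_fun ?_
      intro n
      rw [Finset.mul_sum]
      refine Finset.sum_congr rfl fun β hβ => ?_
      have : ∑ i, β i = n := by simpa using hβ
      simp only [PiLp.smul_apply, smul_eq_mul, mul_pow, Finset.prod_mul_distrib,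
        Finset.prod_pow_eq_pow_sum, this, mul_assoc]
  set n := ∑ i, α i with hn
  let P : MvPolynomial (Fin d) ℂ := ∑ β ∈ Finset.piAntidiag Finset.univ n,
    MvPolynomial.monomial (Finsupp.equivFunOnFinite.symm β) (q β)
  have hP : P = 0 := by
    have hs : (Metric.ball (0 : ℂ) (1 / (d + 1))).Infinite := by
      refine infinite_of_mem_nhds 0 (Metric.ball_mem_nhds _ (by positivity))
    refine MvPolynomial.funext_set (fun _ => Metric.ball (0 : ℂ) (1 / (d + 1))) (fun _ => hs) ?_
    intro x hx
    have hx' : WithLp.toLp 2 x ∈ UBall d := by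
      rw [mem_ball_zero_iff]
      have h4 (i : Fin d) : ‖x i‖ ^ 2 ≤ 1 / (d + 1) := by
        have h5 : ‖x i‖ < 1 / (d + 1) := mem_ball_zero_iff.1 (hx i (Set.mem_univ i))
        have h6 : (1 : ℝ) / (d + 1) ≤ 1 := by
          rw [div_le_one (by positivity)]; linarith [(Nat.cast_nonneg d : (0 : ℝ) ≤ d)]
        nlinarith [norm_nonneg (x i)]
      have h7 : ‖(WithLp.toLp 2 x : EuclideanSpace ℂ (Fin d))‖ ^ 2 < 1 := by
        rw [EuclideanSpace.norm_sq_eq]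
        calc ∑ i, ‖x i‖ ^ 2 ≤ ∑ _i : Fin d, (1 : ℝ) / (d + 1) := Finset.sum_le_sum fun i _ => h4 i
          _ < 1 := by
            rw [Finset.sum_const, Finset.card_univ, Fintype.card_fin, nsmul_eq_mul,
              mul_one_div, div_lt_one (by positivity)]
            linarith
      nlinarith [norm_nonneg (WithLp.toLp 2 x : EuclideanSpace ℂ (Fin d))]
    rw [map_zero, ← h1 ⟨_, hx'⟩ n, map_sum]
    refine Finset.sum_congr rfl fun β _ => ?_
    rw [MvPolynomial.eval_monomial, mul_comm, Finsupp.prod_fintype _ _ (by simp)]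
    rfl
  have := congrArg (MvPolynomial.coeff (Finsupp.equivFunOnFinite.symm α)) hP
  simpa [P, MvPolynomial.coeff_sum, MvPolynomial.coeff_monomial, hn] using this

/-- `H_K(E)` as a Hilbert space of `E`-valued functions on the ball. -/
noncomputable instance : RKHS ℂ (HK κ d E) (UBall d) E where
  coeCLM := ContinuousLinearMap.pi fun z => evalCLM κ E z
  coeCLM_injective := by
    refine (injective_iff_map_eq_zero _).2 fun f hf => ?_
    have h1 (α : Fin d → ℕ) : coeff f α = 0 := by
      refine ext_inner_left ℂ fun v => ?_
      rw [inner_zero_right]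
      refine mvcoeff_eq_zero (q := fun α => inner ℂ v (coeff f α)) (fun z => ?_) α
      have h2 := (hasSum_eval z f).mapL (innerSL ℂ v)
      have h3 : evalCLM κ E z f = 0 := congrFun hf z
      rw [h3] at h2
      simpa [inner_smul_right] using h2
    have h4 : seq f = 0 := by
      ext α
      have h5 := h1 α
      rw [coeff, smul_eq_zero] at h5
      rcases h5 with h5 | h5
      · exact absurd h5 (by exact_mod_cast (Real.sqrt_pos.2 (κ.wt_pos α)).ne')
      · simpa using h5
    exact (LinearIsometryEquiv.map_eq_zero_iff _).1 h4

theorem hasSum_apply (f : HK κ d E) (z : UBall d) :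
    HasSum (fun α : Fin d → ℕ => (∏ i, z.1 i ^ α i) • coeff f α) (f z) :=
  hasSum_eval z f

/-- The function `K(·, w) v`. -/
noncomputable def kvec (κ : KernelSeq) (w : UBall d) (v : E) : HK κ d E :=
  seq.symm ⟨fun α => (((Real.sqrt (κ.wt α) : ℝ) : ℂ) * ∏ i, star (w.1 i) ^ α i) • v,
    memℓp_gen (by
      refine ((summable_wt_ball κ w).mul_right (‖v‖ ^ 2)).congr fun α => ?_
      rw [norm_smul, norm_mul, Complex.norm_real, Real.norm_of_nonneg (Real.sqrt_nonneg _)]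
      simp [mul_pow])⟩

theorem seq_kvec (w : UBall d) (v : E) (α : Fin d → ℕ) :
    seq (kvec κ w v) α =
      (((Real.sqrt (κ.wt α) : ℝ) : ℂ) * ∏ i, star (w.1 i) ^ α i) • v := by
  simp [kvec]

theorem inner_kvec (w : UBall d) (v : E) (f : HK κ d E) :
    inner ℂ (kvec κ w v) f = inner ℂ v (f w) := by
  rw [← LinearIsometryEquiv.inner_map_map seq, lp.inner_eq_tsum]
  have h0 : inner ℂ v (f w) = innerSL ℂ v (f w) := rfl
  rw [h0, ← ((hasSum_apply f w).mapL (innerSL ℂ v)).tsum_eq]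
  refine tsum_congr fun α => ?_
  rw [seq_kvec]
  simp only [innerSL_apply_apply, inner_smul_left, inner_smul_right, coeff, map_mul,
    Complex.conj_ofReal, map_prod, map_pow]
  simp only [Complex.star_def, Complex.conj_conj]
  ring

theorem kerFun_eq (w : UBall d) (v : E) : RKHS.kerFun (HK κ d E) w v = kvec κ w v := by
  refine ext_inner_right ℂ fun f => ?_
  rw [RKHS.kerFun_inner, inner_kvec]

/-- The reproducing kernel of `H_K(E)` is `K(z, w) 1_E` with `K(z, w) = k(⟨z, w⟩)`, where
`⟨z, w⟩ = ∑ zᵢ w̄ᵢ`. -/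
theorem kernel_eq (z w : UBall d) :
    RKHS.kernel (HK κ d E) z w =
      κ.k (∑ i, z.1 i * star (w.1 i)) • ContinuousLinearMap.id ℂ E := by
  ext v
  rw [← RKHS.kerFun_apply, kerFun_eq]
  have hzw : ∑ i, ‖z.1 i * star (w.1 i)‖ < 1 := by
    have h1 : ∑ i, ‖z.1 i‖ ^ 2 < 1 := by
      rw [← EuclideanSpace.norm_sq_eq]
      have := mem_ball_zero_iff.1 z.2
      nlinarith [norm_nonneg z.1]
    have h2 : ∑ i, ‖w.1 i‖ ^ 2 < 1 := by
      rw [← EuclideanSpace.norm_sq_eq]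
      have := mem_ball_zero_iff.1 w.2
      nlinarith [norm_nonneg w.1]
    calc ∑ i, ‖z.1 i * star (w.1 i)‖ ≤ ∑ i, (‖z.1 i‖ ^ 2 + ‖w.1 i‖ ^ 2) / 2 := by
          refine Finset.sum_le_sum fun i _ => ?_
          rw [norm_mul, norm_star]
          nlinarith [sq_nonneg (‖z.1 i‖ - ‖w.1 i‖)]
      _ < 1 := by rw [← Finset.sum_div, Finset.sum_add_distrib]; linarith
  have h3 := (κ.hasSum_wt hzw).smul_const v
  refine (hasSum_apply (kvec κ w v) z).unique (h3.congr_fun fun α => ?_)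
  rw [coeff, seq_kvec, smul_smul, smul_smul]
  congr 1
  have h4 : ((Real.sqrt (κ.wt α) : ℝ) : ℂ) * ((Real.sqrt (κ.wt α) : ℝ) : ℂ) = (κ.wt α : ℂ) := by
    exact_mod_cast Real.mul_self_sqrt (κ.wt_pos α).le
  rw [← h4]
  simp only [mul_pow, Finset.prod_mul_distrib]
  ring

theorem multinomial_le (α : Fin d → ℕ) (i : Fin d) :
    Nat.multinomial Finset.univ α ≤ Nat.multinomial Finset.univ (α + Pi.single i 1) := by
  have h1 := Nat.multinomial_spec Finset.univ α
  have h2 := Nat.multinomial_spec Finset.univ (α + Pi.single i 1)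
  have h3 : ∏ j, ((α + Pi.single i 1 : Fin d → ℕ) j).factorial = (α i + 1) * ∏ j, (α j).factorial := by
    rw [← Finset.mul_prod_erase _ _ (Finset.mem_univ i),
      ← Finset.mul_prod_erase Finset.univ (fun j => (α j).factorial) (Finset.mem_univ i)]
    rw [← mul_assoc]
    congr 1
    · simp [Nat.factorial_succ]
    · refine Finset.prod_congr rfl fun j hj => ?_
      simp [Finset.ne_of_mem_erase hj]
  have h4 : ∑ j, (α + Pi.single i 1 : Fin d → ℕ) j = ∑ j, α j + 1 := by
    simp [Finset.sum_add_distrib]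
  rw [h3, h4, Nat.factorial_succ, ← h1] at h2
  have h5 : 0 < ∏ j, (α j).factorial := Finset.prod_pos fun j _ => Nat.factorial_pos _
  have h6 : (α i + 1) * Nat.multinomial Finset.univ (α + Pi.single i 1) =
      (∑ j, α j + 1) * Nat.multinomial Finset.univ α := by
    apply Nat.eq_of_mul_eq_mul_left h5
    linarith
  have h7 : α i ≤ ∑ j, α j := Finset.single_le_sum (fun _ _ => Nat.zero_le _) (Finset.mem_univ i)
  refine Nat.le_of_mul_le_mul_left ?_ (Nat.succ_pos (α i))
  rw [Nat.succ_eq_add_one, h6]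
  exact Nat.mul_le_mul_right _ (by omega)

theorem shift_bound (κ : KernelSeq) (i : Fin d) (α : Fin d → ℕ) :
    |Real.sqrt (κ.wt α / κ.wt (α + Pi.single i 1))| ≤
      Real.sqrt (⨆ n, κ.a n / κ.a (n + 1)) := by
  rw [abs_of_nonneg (Real.sqrt_nonneg _)]
  refine Real.sqrt_le_sqrt (le_trans ?_ (κ.ratio_le (∑ j, α j)))
  have h4 : ∑ j, (α + Pi.single i 1 : Fin d → ℕ) j = ∑ j, α j + 1 := by
    simp [Finset.sum_add_distrib]
  have h5 : (Nat.multinomial Finset.univ α : ℝ) ≤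
      Nat.multinomial Finset.univ (α + Pi.single i 1) := by exact_mod_cast multinomial_le α i
  have h6 : (0 : ℝ) < Nat.multinomial Finset.univ α := by exact_mod_cast Nat.multinomial_pos _ _
  rw [KernelSeq.wt, KernelSeq.wt, h4, mul_div_mul_comm]
  have h7 := div_pos (κ.a_pos (∑ j, α j)) (κ.a_pos (∑ j, α j + 1))
  exact mul_le_of_le_one_right h7.le ((div_le_one (h6.trans_le h5)).2 h5)

/-- The adjoint of the multiplication by the `i`-th coordinate function: in Taylor coefficients,
`f_α ↦ (ω_α / ω_{α + e_i}) f_{α + e_i}` with `ω_α = a_{|α|} γ_α`. -/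
noncomputable def backShift (κ : KernelSeq) (E : Type*) [NormedAddCommGroup E]
    [InnerProductSpace ℂ E] (i : Fin d) : HK κ d E →L[ℂ] HK κ d E :=
  wcomp (E := E) (fun α : Fin d → ℕ => α + Pi.single i 1) (add_left_injective _)
    (fun α => Real.sqrt (κ.wt α / κ.wt (α + Pi.single i 1))) _ (shift_bound κ i)

/-- The multiplication operator `M_{z_i}` on `H_K(E)`; see `HK.Mz_apply`. -/
noncomputable def Mz (κ : KernelSeq) (E : Type*) [NormedAddCommGroup E]
    [InnerProductSpace ℂ E] [CompleteSpace E] (i : Fin d) : HK κ d E →L[ℂ] HK κ d E :=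
  ContinuousLinearMap.adjoint (backShift κ E i)

theorem backShift_kvec (i : Fin d) (w : UBall d) (v : E) :
    backShift κ E i (kvec κ w v) = star (w.1 i) • kvec κ w v := by
  apply seq.injective
  rw [map_smul]
  ext α
  have h1 : seq (backShift κ E i (kvec κ w v)) α =
      ((Real.sqrt (κ.wt α / κ.wt (α + Pi.single i 1)) : ℝ) : ℂ) •
        seq (kvec κ w v) (α + Pi.single i 1) := rfl
  rw [h1, lp.coeFn_smul, Pi.smul_apply, seq_kvec, seq_kvec, smul_smul, smul_smul]
  congr 1
  have h2 : ((Real.sqrt (κ.wt α / κ.wt (α + Pi.single i 1)) : ℝ) : ℂ) *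
      ((Real.sqrt (κ.wt (α + Pi.single i 1)) : ℝ) : ℂ) = ((Real.sqrt (κ.wt α) : ℝ) : ℂ) := by
    rw [← Complex.ofReal_mul, ← Real.sqrt_mul (div_pos (κ.wt_pos _) (κ.wt_pos _)).le,
      div_mul_cancel₀ _ (κ.wt_pos _).ne']
  rw [← mul_assoc, h2]
  simp only [Pi.add_apply, pow_add, Finset.prod_mul_distrib]
  have h3 : ∏ j, star (w.1 j) ^ (Pi.single i 1 : Fin d → ℕ) j = star (w.1 i) := by
    rw [Finset.prod_eq_single i] <;> simp +contextual
  rw [h3]; ring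

/-- `M_{z_i}` multiplies by the coordinate function. -/
theorem Mz_apply (i : Fin d) (f : HK κ d E) (z : UBall d) :
    (Mz κ E i f) z = z.1 i • f z := by
  refine ext_inner_left ℂ fun v => ?_
  rw [← inner_kvec, Mz, ContinuousLinearMap.adjoint_inner_right, backShift_kvec,
    inner_smul_left, inner_kvec, inner_smul_right]
  simp

/-- The diagonal operator `∑ f_α z^α ↦ ∑ (a_{|α|+1} / a_{|α|}) f_α z^α`. -/
noncomputable def Delta (κ : KernelSeq) (d : ℕ) (E : Type*) [NormedAddCommGroup E]
    [InnerProductSpace ℂ E] : HK κ d E →L[ℂ] HK κ d E :=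
  wcomp (E := E) (fun α : Fin d → ℕ => α) Function.injective_id
    (fun α => κ.a (∑ i, α i + 1) / κ.a (∑ i, α i)) _
    (fun _ => (abs_of_pos (div_pos (κ.a_pos _) (κ.a_pos _))).trans_le (κ.ratio_inv_le _))

theorem seq_Delta (f : HK κ d E) (α : Fin d → ℕ) :
    seq (Delta κ d E f) α =
      ((κ.a (∑ i, α i + 1) / κ.a (∑ i, α i) : ℝ) : ℂ) • seq f α := rfl

theorem coeff_Delta (f : HK κ d E) (α : Fin d → ℕ) :
    coeff (Delta κ d E f) α =
      ((κ.a (∑ i, α i + 1) / κ.a (∑ i, α i) : ℝ) : ℂ) • coeff f α := by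
  rw [coeff, coeff, seq_Delta, smul_comm]

end HK

section Tuples

variable {d : ℕ} {E F : Type*} [NormedAddCommGroup E] [InnerProductSpace ℂ E]
  [NormedAddCommGroup F] [InnerProductSpace ℂ F]

/-- The power `S^α = S₁^{α₁} ⋯ S_d^{α_d}` of a tuple of operators. -/
noncomputable def tuplePow (S : Fin d → E →L[ℂ] E) (α : Fin d → ℕ) : E →L[ℂ] E :=
  (List.ofFn fun i => S i ^ α i).prod

/-- The row operator `E^d → F`, `(x_i) ↦ ∑ S_i x_i`. -/
noncomputable def rowOp (S : Fin d → E →L[ℂ] F) : PiLp 2 (fun _ : Fin d => E) →L[ℂ] F :=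
  ∑ i, S i ∘L PiLp.proj 2 (fun _ : Fin d => E) i

/-- The direct sum `⊕ A : E^d → F^d`. -/
noncomputable def oplus (d : ℕ) (A : E →L[ℂ] F) :
    PiLp 2 (fun _ : Fin d => E) →L[ℂ] PiLp 2 (fun _ : Fin d => F) :=
  (PiLp.continuousLinearEquiv 2 ℂ (fun _ : Fin d => F)).symm.toContinuousLinearMap ∘L
    ContinuousLinearMap.pi fun i => A ∘L PiLp.proj 2 (fun _ : Fin d => E) i

/-- The row operator `Z : H^d → H`, `(h_i) ↦ ∑ z_i h_i`. -/
noncomputable def rowZ (H : Type*) [NormedAddCommGroup H] [InnerProductSpace ℂ H]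
    (z : EuclideanSpace ℂ (Fin d)) : PiLp 2 (fun _ : Fin d => H) →L[ℂ] H :=
  rowOp fun i => z i • ContinuousLinearMap.id ℂ H

@[simp]
theorem rowOp_apply (S : Fin d → E →L[ℂ] F) (x : PiLp 2 (fun _ : Fin d => E)) :
    rowOp S x = ∑ i, S i (x i) := by
  simp [rowOp]

@[simp]
theorem oplus_apply (A : E →L[ℂ] F) (x : PiLp 2 (fun _ : Fin d => E)) (i : Fin d) :
    oplus d A x i = A (x i) := rfl

/-- The defect operator `D_A = (1 - A^* A)^{1/2}` of a contraction `A`. -/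
noncomputable def defectOp [CompleteSpace E] [CompleteSpace F] (A : E →L[ℂ] F) : E →L[ℂ] E :=
  CFC.sqrt (1 - ContinuousLinearMap.adjoint A ∘L A)

/-- The wandering subspace `L ⊖ ∑ S_i L` associated with a tuple `S` on `L`. -/
noncomputable def wanderingSubspace (S : Fin d → E →L[ℂ] E) (L : Submodule ℂ E) :
    Submodule ℂ E :=
  L ⊓ (⨆ i, L.map (S i).toLinearMap)ᗮ

end Tuples

/-- `K`-inner functions: `W` is analytic on the ball, `x ↦ W x` is a well-defined isometry
`E₁ → H_K(E)` and `W E₁ ⟂ M_z^α (W E₁)` for all `α ≠ 0`. Only the values of `W` on the ball matter. -/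
def IsKInner (κ : KernelSeq) {d : ℕ} {E₁ E : Type*} [NormedAddCommGroup E₁]
    [InnerProductSpace ℂ E₁] [NormedAddCommGroup E] [InnerProductSpace ℂ E] [CompleteSpace E]
    (W : EuclideanSpace ℂ (Fin d) → E₁ →L[ℂ] E) : Prop :=
  AnalyticOnNhd ℂ W (UBall d) ∧
    ∃ V : E₁ →ₗᵢ[ℂ] HK κ d E, (∀ (x : E₁) (z : UBall d), V x z = W z x) ∧
      ∀ α : Fin d → ℕ, α ≠ 0 → ∀ x y : E₁, inner ℂ (V x) (tuplePow (HK.Mz κ E) α (V y)) = 0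

section Contractions

variable {d : ℕ} {H : Type*} [NormedAddCommGroup H] [InnerProductSpace ℂ H] [CompleteSpace H]

/-- The map `σ_T(X) = ∑ T_i X T_i^*`. -/
noncomputable def sigmaMap (T : Fin d → H →L[ℂ] H) (X : H →L[ℂ] H) : H →L[ℂ] H :=
  ∑ i, T i ∘L X ∘L ContinuousLinearMap.adjoint (T i)

/-- `P` is the limit of `∑ cₙ σ_Tⁿ(1)` in the strong operator topology. -/
def IsRecipLimit (κ : KernelSeq) (T : Fin d → H →L[ℂ] H) (P : H →L[ℂ] H) : Prop :=
  ∀ h : H, Tendsto (fun N => ∑ n ∈ Finset.range N, κ.c n • ((sigmaMap T)^[n] 1) h) atTop (𝓝 (P h))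

/-- `T` is a `K`-contraction. -/
def IsKContraction (κ : KernelSeq) (T : Fin d → H →L[ℂ] H) : Prop :=
  (∀ i j, Commute (T i) (T j)) ∧ ∃ P : H →L[ℂ] H, P.IsPositive ∧ IsRecipLimit κ T P

open Classical in
/-- The operator `(1/K)(T)` (equal to `0` if the defining series does not converge). -/
noncomputable def recipK (κ : KernelSeq) (T : Fin d → H →L[ℂ] H) : H →L[ℂ] H :=
  if h : ∃ P : H →L[ℂ] H, IsRecipLimit κ T P then h.choose else 0

theorem IsRecipLimit.unique {κ : KernelSeq} {T : Fin d → H →L[ℂ] H} {P Q : H →L[ℂ] H}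
    (hP : IsRecipLimit κ T P) (hQ : IsRecipLimit κ T Q) : P = Q :=
  ContinuousLinearMap.ext fun h => tendsto_nhds_unique (hP h) (hQ h)

theorem recipK_eq {κ : KernelSeq} {T : Fin d → H →L[ℂ] H} {P : H →L[ℂ] H}
    (hP : IsRecipLimit κ T P) : recipK κ T = P := by
  have h : ∃ P : H →L[ℂ] H, IsRecipLimit κ T P := ⟨P, hP⟩
  rw [recipK, dif_pos h]
  exact h.choose_spec.unique hP

/-- Pureness of a `K`-contraction. -/
def IsPure (κ : KernelSeq) (T : Fin d → H →L[ℂ] H) : Prop :=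
  ∀ h : H, Tendsto
    (fun N => h - ∑ n ∈ Finset.range (N + 1), (κ.a n : ℂ) • ((sigmaMap T)^[n] (recipK κ T)) h)
    atTop (𝓝 0)

theorem sigmaMap_iterate (T : Fin d → H →L[ℂ] H) (hT : ∀ i j, Commute (T i) (T j))
    (X : H →L[ℂ] H) (n : ℕ) :
    (sigmaMap T)^[n] X = ∑ α ∈ Finset.piAntidiag Finset.univ n,
      (Nat.multinomial Finset.univ α : ℂ) •
        (tuplePow T α ∘L X ∘L tuplePow (fun i => ContinuousLinearMap.adjoint (T i)) α) := by
  classical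
  let L : Fin d → Module.End ℂ (H →L[ℂ] H) := fun i =>
    { toFun := fun X => T i ∘L X ∘L ContinuousLinearMap.adjoint (T i)
      map_add' := fun X Y => by ext; simp
      map_smul' := fun t X => by ext; simp }
  have hL (i : Fin d) (X : H →L[ℂ] H) :
      L i X = T i * X * ContinuousLinearMap.adjoint (T i) := by
    rw [mul_assoc]; rfl
  have hadj (i j : Fin d) : Commute (ContinuousLinearMap.adjoint (T i))
      (ContinuousLinearMap.adjoint (T j)) := by
    have := (hT i j).star_star
    rwa [ContinuousLinearMap.star_eq_adjoint, ContinuousLinearMap.star_eq_adjoint] at this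
  have hcomm : ∀ a ∈ Set.range L, ∀ b ∈ Set.range L, a * b = b * a := by
    rintro _ ⟨i, rfl⟩ _ ⟨j, rfl⟩
    refine LinearMap.ext fun X => ?_
    rw [Module.End.mul_apply, Module.End.mul_apply, hL, hL, hL, hL]
    have h1 := (hT i j).eq
    have h2 := (hadj i j).eq
    calc T i * (T j * X * ContinuousLinearMap.adjoint (T j)) * ContinuousLinearMap.adjoint (T i)
        = (T i * T j) * X *
          (ContinuousLinearMap.adjoint (T j) * ContinuousLinearMap.adjoint (T i)) := by
          simp only [mul_assoc]
      _ = _ := by rw [h1, ← h2]; simp only [mul_assoc]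
  have hc := Algebra.isMulCommutative_adjoin ℂ hcomm
  let _ : CommRing (Algebra.adjoin ℂ (Set.range L)) :=
    { (inferInstance : Ring (Algebra.adjoin ℂ (Set.range L))) with
      mul_comm := fun a b => hc.is_comm.comm a b }
  let l : Fin d → Algebra.adjoin ℂ (Set.range L) := fun i =>
    ⟨L i, Algebra.subset_adjoin ⟨i, rfl⟩⟩
  have hpow (i : Fin d) (m : ℕ) (X : H →L[ℂ] H) :
      (L i ^ m) X = T i ^ m * X * ContinuousLinearMap.adjoint (T i) ^ m := by
    induction m with
    | zero => simp
    | succ m ih =>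
      rw [pow_succ', Module.End.mul_apply, ih, hL, pow_succ', pow_succ]
      simp only [mul_assoc]
  have hprod (α : Fin d → ℕ) (X : H →L[ℂ] H) :
      ((List.ofFn fun i => L i ^ α i).prod) X =
        tuplePow T α * X * tuplePow (fun i => ContinuousLinearMap.adjoint (T i)) α := by
    have hl (s : List (Fin d)) : (s.map fun i => L i ^ α i).prod X =
        (s.map fun i => T i ^ α i).prod * X *
          (s.map fun i => ContinuousLinearMap.adjoint (T i) ^ α i).prod := by
      induction s with
      | nil => simp
      | cons i s ih =>
        have hc : Commute (ContinuousLinearMap.adjoint (T i) ^ α i)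
            (s.map fun i => ContinuousLinearMap.adjoint (T i) ^ α i).prod := by
          refine Commute.list_prod_right _ _ fun y hy => ?_
          obtain ⟨j, _, rfl⟩ := List.mem_map.1 hy
          exact (hadj i j).pow_pow _ _
        rw [List.map_cons, List.map_cons, List.map_cons, List.prod_cons, List.prod_cons,
          List.prod_cons, Module.End.mul_apply, ih, hpow, hc.eq]
        simp only [mul_assoc]
    rw [tuplePow, tuplePow, List.ofFn_eq_map, List.ofFn_eq_map, List.ofFn_eq_map]
    exact hl _
  have h1 := Finset.sum_pow_eq_sum_piAntidiag (Finset.univ : Finset (Fin d)) l n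
  have h2 := congrArg (fun q => (Algebra.adjoin ℂ (Set.range L)).val q X) h1
  have h3 : (sigmaMap T)^[n] X = ((∑ i, L i) ^ n) X := by
    rw [Module.End.pow_apply]
    congr 1
    funext Y
    rw [LinearMap.sum_apply]; rfl
  rw [h3]
  have h4 : (Algebra.adjoin ℂ (Set.range L)).val ((∑ i, l i) ^ n) = (∑ i, L i) ^ n := by
    rw [map_pow, map_sum]; rfl
  rw [← h4, h2, map_sum, LinearMap.sum_apply]
  refine Finset.sum_congr rfl fun α _ => ?_
  rw [← List.prod_ofFn, map_mul, map_natCast, map_list_prod, List.map_ofFn, Module.End.mul_apply]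
  have h5 : (List.ofFn ((Algebra.adjoin ℂ (Set.range L)).val ∘ fun i => l i ^ α i)) =
      List.ofFn fun i => L i ^ α i := by
    congr 1
  rw [h5, hprod, Module.End.natCast_apply, ← Nat.cast_smul_eq_nsmul ℂ, mul_assoc]
  rfl

end Contractions

theorem adjoint_tuplePow {d : ℕ} {H : Type*} [NormedAddCommGroup H] [InnerProductSpace ℂ H]
    [CompleteSpace H] (T : Fin d → H →L[ℂ] H) (hT : ∀ i j, Commute (T i) (T j))
    (α : Fin d → ℕ) : ContinuousLinearMap.adjoint (tuplePow T α) =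
      tuplePow (fun i => ContinuousLinearMap.adjoint (T i)) α := by
  have hl (s : List (Fin d)) : star ((s.map fun i => T i ^ α i).prod) =
      (s.map fun i => star (T i) ^ α i).prod := by
    induction s with
    | nil => simp
    | cons i s ih =>
      have hc : Commute (star (T i) ^ α i) (s.map fun i => star (T i) ^ α i).prod := by
        refine Commute.list_prod_right _ _ fun y hy => ?_
        obtain ⟨j, _, rfl⟩ := List.mem_map.1 hy
        exact ((hT i j).star_star).pow_pow _ _
      rw [List.map_cons, List.map_cons, List.prod_cons, List.prod_cons, star_mul, ih, star_pow,
        hc.eq]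
  rw [tuplePow, tuplePow, List.ofFn_eq_map, List.ofFn_eq_map]
  exact hl _

/-- A pure `K`-contraction on `H`. -/
structure PureKContraction (κ : KernelSeq) (d : ℕ) (H : Type*) [NormedAddCommGroup H]
    [InnerProductSpace ℂ H] [CompleteSpace H] where
  T : Fin d → H →L[ℂ] H
  isKContraction : IsKContraction κ T
  isPure : IsPure κ T

namespace PureKContraction

variable {κ : KernelSeq} {d : ℕ} {H : Type*} [NormedAddCommGroup H] [InnerProductSpace ℂ H]
  [CompleteSpace H] (S : PureKContraction κ d H)

/-- The defect operator `C = (1/K)(T)^{1/2}`. -/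
noncomputable def C : H →L[ℂ] H := CFC.sqrt (recipK κ S.T)

/-- The defect space, the closure of the range of `C`. -/
noncomputable def defectSpace : Submodule ℂ H := S.C.range.topologicalClosure

noncomputable instance : CompleteSpace S.defectSpace :=
  (Submodule.isClosed_topologicalClosure _).completeSpace_coe

theorem C_mem (h : H) : S.C h ∈ S.defectSpace :=
  Submodule.le_topologicalClosure _ ⟨h, rfl⟩

/-- `C` as an operator into the defect space. -/
noncomputable def C' : H →L[ℂ] S.defectSpace := S.C.codRestrict S.defectSpace S.C_mem

/-- The operator `T^{*α}`. -/
noncomputable def adjPow (α : Fin d → ℕ) : H →L[ℂ] H :=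
  tuplePow (fun i => ContinuousLinearMap.adjoint (S.T i)) α

theorem C_mul_C : S.C * S.C = recipK κ S.T := by
  obtain ⟨P, hP, hlim⟩ := S.isKContraction.2
  refine CFC.sqrt_mul_sqrt_self _ ?_
  rw [recipK_eq hlim]
  exact (ContinuousLinearMap.nonneg_iff_isPositive P).2 hP

theorem inner_sigma (n : ℕ) (h : H) :
    inner ℂ h ((sigmaMap S.T)^[n] (recipK κ S.T) h) =
      ((∑ α ∈ Finset.piAntidiag Finset.univ n,
        (Nat.multinomial Finset.univ α : ℝ) * ‖S.C (S.adjPow α h)‖ ^ 2 : ℝ) : ℂ) := by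
  have hC : IsSelfAdjoint S.C := IsSelfAdjoint.of_nonneg (CFC.sqrt_nonneg _)
  rw [sigmaMap_iterate _ S.isKContraction.1, sum_apply, inner_sum]
  push_cast
  refine Finset.sum_congr rfl fun α _ => ?_
  change inner ℂ h ((Nat.multinomial Finset.univ α : ℂ) •
    tuplePow S.T α (recipK κ S.T (S.adjPow α h))) = _
  rw [inner_smul_right, ← ContinuousLinearMap.adjoint_inner_left,
    adjoint_tuplePow _ S.isKContraction.1, ← S.C_mul_C]
  congr 1
  change inner ℂ (S.adjPow α h) (S.C (S.C (S.adjPow α h))) = _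
  rw [← ContinuousLinearMap.adjoint_inner_left, ← ContinuousLinearMap.star_eq_adjoint, hC.star_eq,
    inner_self_eq_norm_sq_to_K]
  rfl

theorem hasSum_norm (h : H) :
    HasSum (fun α : Fin d → ℕ => κ.wt α * ‖S.C (S.adjPow α h)‖ ^ 2) (‖h‖ ^ 2) := by
  have h1 : HasSum (fun n => κ.a n * ∑ α ∈ Finset.piAntidiag Finset.univ n,
        (Nat.multinomial Finset.univ α : ℝ) * ‖S.C (S.adjPow α h)‖ ^ 2) (‖h‖ ^ 2) := by
    rw [hasSum_iff_tendsto_nat_of_nonneg (fun n => mul_nonneg (κ.a_pos n).le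
      (Finset.sum_nonneg fun α _ => by positivity)), ← tendsto_add_atTop_iff_nat 1]
    have h2 := ((S.isPure h).const_sub h)
    simp only [sub_sub_cancel, sub_zero] at h2
    have h3 := ((innerSL ℂ h).continuous.tendsto _).comp h2
    have h4 := (Complex.continuous_re.tendsto _).comp h3
    have h5 : (innerSL ℂ h h).re = ‖h‖ ^ 2 := by
      rw [innerSL_apply_apply, inner_self_eq_norm_sq_to_K]
      norm_cast
    rw [h5] at h4
    refine h4.congr fun N => ?_
    simp only [Function.comp_apply, map_sum, map_smul, innerSL_apply_apply, S.inner_sigma,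
      smul_eq_mul, Complex.re_sum]
    refine Finset.sum_congr rfl fun n _ => ?_
    rw [← Complex.ofReal_mul, Complex.ofReal_re]
  have h6 : Summable (fun α : Fin d → ℕ => κ.wt α * ‖S.C (S.adjPow α h)‖ ^ 2) := by
    refine summable_of_degree (fun α => mul_nonneg (κ.wt_pos α).le (by positivity))
      (h1.summable.congr fun n => ?_)
    rw [Finset.mul_sum]
    refine Finset.sum_congr rfl fun α hα => ?_
    have : ∑ i, α i = n := by simpa using hα
    rw [KernelSeq.wt, this, mul_assoc]
  have h7 := hasSum_degree h6.hasSum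
  have h8 := h7.unique (h1.congr_fun fun n => by
    rw [Finset.mul_sum]
    refine Finset.sum_congr rfl fun α hα => ?_
    have : ∑ i, α i = n := by simpa using hα
    rw [KernelSeq.wt, this, mul_assoc])
  rw [← h8]
  exact h6.hasSum

theorem norm_coord (h : H) (α : Fin d → ℕ) :
    ‖((Real.sqrt (κ.wt α) : ℝ) : ℂ) • S.C' (S.adjPow α h)‖ ^ 2 =
      κ.wt α * ‖S.C (S.adjPow α h)‖ ^ 2 := by
  rw [norm_smul, mul_pow, Complex.norm_real, Real.norm_eq_abs, sq_abs,
    Real.sq_sqrt (κ.wt_pos α).le]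
  rfl

/-- The canonical `K`-dilation `j h = ∑ a_{|α|} γ_α (C T^{*α} h) z^α`; see `coeff_j`. -/
noncomputable def j : H →ₗᵢ[ℂ] HK κ d S.defectSpace where
  toFun h := HK.seq.symm ⟨fun α => ((Real.sqrt (κ.wt α) : ℝ) : ℂ) • S.C' (S.adjPow α h),
    memℓp_gen (by
      simpa only [ENNReal.toReal_ofNat, Real.rpow_two, S.norm_coord] using (S.hasSum_norm h).summable)⟩
  map_add' h h' := by
    rw [← map_add]; congr 1
    exact Subtype.ext (funext fun α => by
      change ((Real.sqrt (κ.wt α) : ℝ) : ℂ) • S.C' (S.adjPow α (h + h')) =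
        ((Real.sqrt (κ.wt α) : ℝ) : ℂ) • S.C' (S.adjPow α h) +
          ((Real.sqrt (κ.wt α) : ℝ) : ℂ) • S.C' (S.adjPow α h')
      rw [map_add, map_add, smul_add])
  map_smul' t h := by
    rw [RingHom.id_apply, ← map_smul]; congr 1
    exact Subtype.ext (funext fun α => by
      change ((Real.sqrt (κ.wt α) : ℝ) : ℂ) • S.C' (S.adjPow α (t • h)) =
        t • ((Real.sqrt (κ.wt α) : ℝ) : ℂ) • S.C' (S.adjPow α h)
      rw [map_smul, map_smul, smul_comm])
  norm_map' h := by
    have h1 := (lp.hasSum_norm (p := 2) (by norm_num)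
      (⟨fun α => ((Real.sqrt (κ.wt α) : ℝ) : ℂ) • S.C' (S.adjPow α h),
        memℓp_gen (by
      simpa only [ENNReal.toReal_ofNat, Real.rpow_two, S.norm_coord] using (S.hasSum_norm h).summable)⟩ :
        lp (fun _ : Fin d → ℕ => S.defectSpace) 2))
    simp only [ENNReal.toReal_ofNat, Real.rpow_two, S.norm_coord] at h1
    have h2 := h1.unique (S.hasSum_norm h)
    rw [sq_eq_sq₀ (norm_nonneg _) (norm_nonneg _)] at h2
    change ‖HK.seq.symm _‖ = _
    rw [LinearIsometryEquiv.norm_map]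
    exact h2

theorem coeff_j (h : H) (α : Fin d → ℕ) :
    HK.coeff (S.j h) α = (κ.wt α : ℂ) • S.C' (S.adjPow α h) := by
  have h4 : ((Real.sqrt (κ.wt α) : ℝ) : ℂ) * ((Real.sqrt (κ.wt α) : ℝ) : ℂ) = (κ.wt α : ℂ) := by
    exact_mod_cast Real.mul_self_sqrt (κ.wt_pos α).le
  rw [← h4, mul_smul]
  rfl

/-- The subspace `M = H_K(𝒟) ⊖ Im j`. -/
noncomputable def M : Submodule ℂ (HK κ d S.defectSpace) := (S.j.toLinearMap.range)ᗮ

/-- The operator `Δ_T = j^* Δ j`. -/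
noncomputable def DeltaT : H →L[ℂ] H :=
  ContinuousLinearMap.adjoint S.j.toContinuousLinearMap ∘L
    HK.Delta κ d S.defectSpace ∘L S.j.toContinuousLinearMap

theorem inner_Delta {E : Type*} [NormedAddCommGroup E] [InnerProductSpace ℂ E] [CompleteSpace E]
    (f g : HK κ d E) :
    inner ℂ (HK.Delta κ d E f) g = inner ℂ f (HK.Delta κ d E g) := by
  rw [← LinearIsometryEquiv.inner_map_map HK.seq, ← LinearIsometryEquiv.inner_map_map HK.seq f,
    lp.inner_eq_tsum, lp.inner_eq_tsum]
  refine tsum_congr fun α => ?_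
  rw [HK.seq_Delta, HK.seq_Delta, inner_smul_left, inner_smul_right, Complex.conj_ofReal]

theorem Delta_lower {E : Type*} [NormedAddCommGroup E] [InnerProductSpace ℂ E] [CompleteSpace E]
    (f : HK κ d E) :
    (⨆ m, κ.a m / κ.a (m + 1))⁻¹ * ‖f‖ ^ 2 ≤ (inner ℂ (HK.Delta κ d E f) f).re := by
  have h0 : HasSum (fun α => ‖HK.seq f α‖ ^ 2) (‖f‖ ^ 2) := by
    have := lp.hasSum_norm (p := 2) (by norm_num) (HK.seq f)
    rw [LinearIsometryEquiv.norm_map] at this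
    simpa using this
  have h1 : HasSum (fun α => κ.a (∑ i, α i + 1) / κ.a (∑ i, α i) * ‖HK.seq f α‖ ^ 2)
      (inner ℂ (HK.Delta κ d E f) f).re := by
    rw [← LinearIsometryEquiv.inner_map_map HK.seq]
    have h2 := lp.hasSum_inner (𝕜 := ℂ) (HK.seq (HK.Delta κ d E f)) (HK.seq f)
    have h3 := h2.mapL Complex.reCLM
    refine h3.congr_fun fun α => ?_
    rw [HK.seq_Delta, inner_smul_left, Complex.conj_ofReal, inner_self_eq_norm_sq_to_K]
    simp only [Complex.reCLM_apply, Complex.re_ofReal_mul]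
    norm_cast
  refine hasSum_le (fun α => ?_) (h0.mul_left _) h1
  refine mul_le_mul_of_nonneg_right ?_ (sq_nonneg _)
  rw [← inv_div]
  exact inv_anti₀ (div_pos (κ.a_pos _) (κ.a_pos _)) (κ.ratio_le _)

theorem inner_DeltaT (x y : H) :
    inner ℂ (S.DeltaT x) y = inner ℂ (HK.Delta κ d S.defectSpace (S.j x)) (S.j y) := by
  rw [DeltaT, ContinuousLinearMap.comp_apply, ContinuousLinearMap.adjoint_inner_left]
  rfl

theorem DeltaT_lower (x : H) :
    (⨆ m, κ.a m / κ.a (m + 1))⁻¹ * ‖x‖ ^ 2 ≤ (inner ℂ (S.DeltaT x) x).re := by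
  rw [inner_DeltaT, ← S.j.norm_map x]
  exact Delta_lower _

theorem sup_inv_pos (κ : KernelSeq) : 0 < (⨆ m, κ.a m / κ.a (m + 1))⁻¹ :=
  inv_pos.2 ((div_pos (κ.a_pos 0) (κ.a_pos 1)).trans_le (κ.ratio_le 0))

/-- The space `H̃`: the vector space `H` with the scalar product `⟨Δ_T x, y⟩`. -/
def HTilde (_S : PureKContraction κ d H) : Type _ := H

noncomputable instance : AddCommGroup S.HTilde := inferInstanceAs (AddCommGroup H)

noncomputable instance : Module ℂ S.HTilde := inferInstanceAs (Module ℂ H)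

/-- The identity `H → H̃` as a linear map. -/
noncomputable def toTilde : H ≃ₗ[ℂ] S.HTilde := LinearEquiv.refl ℂ H

/-- The scalar product of `H̃`. -/
@[reducible] noncomputable def tildeCore : InnerProductSpace.Core ℂ S.HTilde where
  inner x y := inner ℂ (S.DeltaT (S.toTilde.symm x)) (S.toTilde.symm y)
  conj_inner_symm x y := by
    rw [inner_conj_symm, inner_DeltaT, inner_Delta, DeltaT, ContinuousLinearMap.comp_apply,
      ContinuousLinearMap.adjoint_inner_right]
    rfl
  re_inner_nonneg x := by
    have h := S.DeltaT_lower (S.toTilde.symm x)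
    exact (mul_nonneg (sup_inv_pos κ).le (sq_nonneg _)).trans h
  add_left x y z := by rw [map_add, map_add, inner_add_left]
  smul_left x y t := by rw [map_smul, map_smul, inner_smul_left]
  definite x hx := by
    have h := S.DeltaT_lower (S.toTilde.symm x)
    rw [hx, Complex.zero_re] at h
    have h1 : ‖S.toTilde.symm x‖ ^ 2 ≤ 0 := nonpos_of_mul_nonpos_right h (sup_inv_pos κ)
    have h2 : S.toTilde.symm x = 0 := by
      rw [← norm_eq_zero]; exact pow_eq_zero_iff two_ne_zero |>.1 (le_antisymm h1 (sq_nonneg _))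
    exact (LinearEquiv.map_eq_zero_iff _).1 h2

noncomputable instance : NormedAddCommGroup S.HTilde := S.tildeCore.toNormedAddCommGroup

noncomputable instance : InnerProductSpace ℂ S.HTilde := InnerProductSpace.ofCore S.tildeCore.toCore

theorem tilde_inner (x y : H) :
    inner ℂ (S.toTilde x) (S.toTilde y) = inner ℂ (S.DeltaT x) y := rfl

theorem tilde_norm_sq (x : H) : ‖S.toTilde x‖ ^ 2 = (inner ℂ (S.DeltaT x) x).re := by
  rw [← S.tilde_inner, inner_self_eq_norm_sq_to_K]
  norm_cast

/-- The invertible operator `I_T : H → H̃`, `x ↦ x`. -/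
noncomputable def IT : H ≃L[ℂ] S.HTilde :=
  S.toTilde.toContinuousLinearEquivOfBounds (Real.sqrt ‖S.DeltaT‖)
    (Real.sqrt (⨆ m, κ.a m / κ.a (m + 1)))
    (fun x => by
      refine (sq_le_sq₀ (norm_nonneg _) (by positivity)).1 ?_
      rw [S.tilde_norm_sq, mul_pow, Real.sq_sqrt (norm_nonneg _)]
      refine (Complex.re_le_norm _).trans ((norm_inner_le_norm _ _).trans ?_)
      rw [sq, ← mul_assoc]
      exact mul_le_mul_of_nonneg_right (S.DeltaT.le_opNorm x) (norm_nonneg _))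
    (fun x => by
      have hpos : 0 < ⨆ m, κ.a m / κ.a (m + 1) := inv_pos.1 (sup_inv_pos κ)
      have h := S.DeltaT_lower (S.toTilde.symm x)
      rw [← S.tilde_norm_sq, LinearEquiv.apply_symm_apply, inv_mul_le_iff₀ hpos] at h
      refine (sq_le_sq₀ (norm_nonneg _) (by positivity)).1 ?_
      rwa [mul_pow, Real.sq_sqrt hpos.le])

noncomputable instance : CompleteSpace S.HTilde :=
  (completeSpace_congr (e := S.IT.toEquiv) S.IT.isUniformEmbedding).1 inferInstance

/-- The row operator `T̃ : H̃^d → H` with components `T̃_i = T_i I_T^*`. -/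
noncomputable def rowTilde : PiLp 2 (fun _ : Fin d => S.HTilde) →L[ℂ] H :=
  rowOp fun i => S.T i ∘L ContinuousLinearMap.adjoint (S.IT : H →L[ℂ] S.HTilde)

/-- The defect operator `D_{T̃} = (1 - T̃^* T̃)^{1/2}` on `H̃^d`. -/
noncomputable def defectTilde :
    PiLp 2 (fun _ : Fin d => S.HTilde) →L[ℂ] PiLp 2 (fun _ : Fin d => S.HTilde) :=
  defectOp S.rowTilde

/-- The operator `(⊕ I_T⁻¹) D_{T̃} : H̃^d → H^d`. -/
noncomputable def invDefect :
    PiLp 2 (fun _ : Fin d => S.HTilde) →L[ℂ] PiLp 2 (fun _ : Fin d => H) :=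
  oplus d (S.IT.symm : S.HTilde →L[ℂ] H) ∘L S.defectTilde

/-- The column operator `M_z^* : H_K(𝒟) → H_K(𝒟)^d`. -/
noncomputable def colMzAdj :
    HK κ d S.defectSpace →L[ℂ] PiLp 2 (fun _ : Fin d => HK κ d S.defectSpace) :=
  ContinuousLinearMap.adjoint (rowOp (HK.Mz κ S.defectSpace))

/-- The space `𝒟̃` of all `y` in the closure of the range of `D_{T̃}` with
`(⊕ j I_T⁻¹) D_{T̃} y ∈ M_z^* H_K(𝒟)`, with the norm of `H̃^d`. -/
noncomputable def tildeD : Submodule ℂ (PiLp 2 (fun _ : Fin d => S.HTilde)) :=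
  S.defectTilde.range.topologicalClosure ⊓
    S.colMzAdj.range.comap
      (oplus d S.j.toContinuousLinearMap ∘L S.invDefect).toLinearMap

/-- The operator `Z T^* = ∑ z_i T_i^*`. -/
noncomputable def ZTadj (z : EuclideanSpace ℂ (Fin d)) : H →L[ℂ] H :=
  ∑ i, z i • ContinuousLinearMap.adjoint (S.T i)

/-- The operator `F(Z T^*)` for `F(ζ) = ∑ a_{n+1} ζⁿ`. -/
noncomputable def FT (z : EuclideanSpace ℂ (Fin d)) : H →L[ℂ] H :=
  ∑' n, (κ.a (n + 1) : ℂ) • S.ZTadj z ^ n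

/-- The operator `W_T(z) = -T̃ + C F(Z T^*) Z (⊕ I_T⁻¹) D_{T̃}` on `𝒟̃`, with values in `H`. -/
noncomputable def WT (z : EuclideanSpace ℂ (Fin d)) : S.tildeD →L[ℂ] H :=
  (-S.rowTilde + S.C ∘L S.FT z ∘L rowZ H z ∘L S.invDefect) ∘L S.tildeD.subtypeL

end PureKContraction

/-! Everything rests on one identity in H_K(E): f = f(0) + Σ_i M_{z_i} Δ M_{z_i}^* f
(`HK.eq_const_add_sum`). On Taylor coefficients the i-th summand multiplies f_β by β_i/|β|, and
these fractions add up to 1 when β ≠ 0. Hence f is determined by f(0) and M_z^* f, and pairing with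
f gives ‖f‖² = ‖f(0)‖² + Σ_i ⟨Δ M_{z_i}^* f, M_{z_i}^* f⟩ (`HK.norm_sq_eq`).

Applying j^* to the identity at f = jh, together with jT_i^* = M_{z_i}^* j, gives T̃T̃^* = 1 - C²
(`rowTilde_comp_adjoint`). So T̃ is a contraction, C is the defect operator of T̃^*, and D_T̃ T̃^* =
T̃^* C.

A function f lies in W(M) exactly when j^* f = 0 and every M_{z_i}^* f lies in M^⊥ = Im j. Put v =
f(0) and M_{z_i}^* f = j x_i, and let x' be the tuple (x_i) viewed in H̃^d. Then j^* f = 0 reads Cv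
+ T̃x' = 0, and the norm formula reads ‖f‖² = ‖v‖² + ‖x'‖². The kernel of the row (C, T̃) is the
range of the isometric column y ↦ (-T̃y, D_T̃ y), with inverse y = D_T̃ x' - T̃^* v on that range.
Writing f in terms of y gives f = -T̃y + Σ_i z_i Δ j(I_T⁻¹ D_T̃ y)_i, and since Δ j h is the
function z ↦ C F(ZT^*) h (`Delta_j_apply`), this is W_T y. The space 𝒟̃ collects those y for which
the required M_z^* f exists (`backShift_innerMap`, `exists_innerMap_eq`).

Norm convergence of F(ZT^*) comes from ‖h‖² = Σ_m a_m q_m(h), with q_m(h) = ⟨σ_T^m(C²)h, h⟩. Each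
factor ZT^* raises the index m by one at the cost of |z|², so a bound a_m ≤ B_n a_{m+n} gives
‖(ZT^*)^n‖ ≤ √B_n |z|^n. The limit of a_n/a_{n+1} exists and is at least 1, which allows a choice of
B_n that makes the series converge on the whole ball. -/

/-! ### Positive square roots and defect operators. -/

section SquareRoots

variable {E F : Type*} [NormedAddCommGroup E] [InnerProductSpace ℂ E] [CompleteSpace E]
  [NormedAddCommGroup F] [InnerProductSpace ℂ F] [CompleteSpace F]

open ContinuousLinearMap in
/-- An operator that intertwines the squares of two positive operators intertwines the operators. -/
theorem ContinuousLinearMap.comp_eq_comp_of_sq {S : F →L[ℂ] F} {R : E →L[ℂ] E} (hS : 0 ≤ S)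
    (hR : 0 ≤ R) (B : E →L[ℂ] F) (h : (S * S) ∘L B = B ∘L (R * R)) : S ∘L B = B ∘L R := by
  have hS' : adjoint S = S := (IsSelfAdjoint.of_nonneg hS).star_eq
  have hR' : adjoint R = R := (IsSelfAdjoint.of_nonneg hR).star_eq
  set Q : E →L[ℂ] F := S ∘L B - B ∘L R with hQ
  set N : E →L[ℂ] E := adjoint Q ∘L Q with hN
  have hN' : adjoint N = N := by rw [hN, adjoint_comp, adjoint_adjoint]
  have hSQ : S ∘L Q = -(Q ∘L R) := by
    -- S(SB - BR) = BR² - SBR = -(SB - BR)R.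
    ext x
    have hx := DFunLike.congr_fun h x
    simp only [comp_apply, mul_apply_eq_comp, sub_apply, neg_apply, map_sub, hQ] at hx ⊢
    rw [hx]; abel
  have hNR : N * R = -(adjoint Q ∘L S ∘L Q) := by
    rw [hSQ, comp_neg, neg_neg]; rfl
  have hP : 0 ≤ adjoint Q ∘L S ∘L Q := by
    rw [nonneg_iff_isPositive] at hS ⊢
    exact hS.adjoint_conj Q
  have hN0 : 0 ≤ N := by
    rw [nonneg_iff_isPositive]
    exact (isPositive_one (𝕜 := ℂ) (E := F)).adjoint_conj Q
  -- N R = -Q^* S Q is self-adjoint, and a self-adjoint product of self-adjoint operators commutes.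
  have hcomm : Commute N R := by
    have h1 := congrArg adjoint hNR
    have h2 : adjoint (N * R) = R * N := by
      conv_rhs => rw [← hN', ← hR']
      exact adjoint_comp N R
    rw [h2, map_neg, adjoint_comp, adjoint_comp, hS', adjoint_adjoint, comp_assoc, ← hNR] at h1
    exact h1.symm
  have h0 : N * R = 0 := by
    -- A product of commuting positive operators is positive, while -Q^* S Q is negative.
    refine le_antisymm ?_ (Commute.mul_nonneg hN0 hR hcomm)
    rw [hNR]
    exact neg_nonpos.2 hP
  have hQR (x : E) : Q (R x) = 0 := by
    have h1 : adjoint Q (Q (R x)) = 0 := DFunLike.congr_fun h0 x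
    rw [← inner_self_eq_zero (𝕜 := ℂ), ← adjoint_inner_left, h1, inner_zero_left]
  have hSQ0 (x : E) : S (Q x) = 0 := by
    have h1 := DFunLike.congr_fun hSQ x
    simpa [hQR] using h1
  have hQN (x : E) : Q (N x) = 0 := by
    -- Since Q^* S = (S Q)^* = 0, expanding the second factor of N = Q^* Q leaves -Q^* B R. The
    -- adjoint of this puts R next to Q in Q N, and Q R = 0.
    have h1 : N = -(R ∘L adjoint B ∘L Q) := by
      have h2 : adjoint Q ∘L S = 0 := by
        rw [← hS', ← adjoint_comp, show S ∘L Q = 0 from ext hSQ0, map_zero]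
      have h3 : N = -(adjoint Q ∘L B ∘L R) := by
        conv_lhs => rw [hN, hQ]
        rw [← hQ, comp_sub, ← comp_assoc, h2, zero_comp, zero_sub]
      rw [← hN', h3, map_neg, adjoint_comp, adjoint_comp, hR', adjoint_adjoint, comp_assoc]
    rw [h1]
    simp [hQR]
  -- N is self-adjoint with N² = Q^*(Q N) = 0.
  have hN1 (x : E) : N x = 0 := by
    rw [← inner_self_eq_zero (𝕜 := ℂ)]
    nth_rw 1 [← hN']
    rw [adjoint_inner_left]
    change inner ℂ x (adjoint Q (Q (N x))) = 0
    rw [hQN, map_zero, inner_zero_right]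
  have hQ0 (x : E) : Q x = 0 := by
    rw [← inner_self_eq_zero (𝕜 := ℂ), ← adjoint_inner_left]
    change inner ℂ (N x) x = 0
    rw [hN1, inner_zero_left]
  exact sub_eq_zero.1 (ext hQ0)

theorem defectOp_nonneg (A : E →L[ℂ] F) : 0 ≤ defectOp A :=
  CFC.sqrt_nonneg (1 - ContinuousLinearMap.adjoint A ∘L A)

theorem defectOp_mul_self (A : E →L[ℂ] F) (hA : 0 ≤ 1 - ContinuousLinearMap.adjoint A ∘L A) :
    defectOp A * defectOp A = 1 - ContinuousLinearMap.adjoint A ∘L A :=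
  CFC.sqrt_mul_sqrt_self _ hA

theorem adjoint_defectOp (A : E →L[ℂ] F) :
    ContinuousLinearMap.adjoint (defectOp A) = defectOp A :=
  (IsSelfAdjoint.of_nonneg (defectOp_nonneg A)).star_eq

open ContinuousLinearMap in
/-- The defect operators of a contraction and its adjoint are intertwined. -/
theorem defectOp_comp_adjoint (A : E →L[ℂ] F) {C : F →L[ℂ] F} (hC : 0 ≤ C)
    (h : A ∘L adjoint A = 1 - C * C) (hA : 0 ≤ 1 - adjoint A ∘L A) :
    defectOp A ∘L adjoint A = adjoint A ∘L C := by
  refine comp_eq_comp_of_sq (defectOp_nonneg A) hC _ ?_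
  have h1 : C * C = 1 - A ∘L adjoint A := by rw [h, sub_sub_cancel]
  rw [defectOp_mul_self A hA, h1]
  ext x
  simp only [comp_apply, sub_apply, one_apply_eq_self, map_sub]

open ContinuousLinearMap in
/-- If `A A^* ≤ 1`, then `A^* A ≤ 1`. -/
theorem one_sub_adjoint_comp_nonneg (A : E →L[ℂ] F) (h : 0 ≤ 1 - A ∘L adjoint A) :
    0 ≤ 1 - adjoint A ∘L A := by
  have h1 : ‖adjoint A‖ ≤ 1 := by
    refine opNorm_le_bound _ zero_le_one fun x => ?_
    have h2 := ((nonneg_iff_isPositive _).1 h).re_inner_nonneg_right x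
    simp only [sub_apply, one_apply_eq_self, comp_apply, inner_sub_right, map_sub] at h2
    rw [← adjoint_inner_left, inner_self_eq_norm_sq, inner_self_eq_norm_sq] at h2
    rw [one_mul]
    exact (sq_le_sq₀ (norm_nonneg _) (norm_nonneg _)).1 (by linarith)
  rw [nonneg_iff_isPositive]
  refine (isPositive_iff_complex _).2 fun x => ?_
  have h3 : ‖A x‖ ≤ ‖x‖ := by
    rw [LinearIsometryEquiv.norm_map] at h1
    simpa using (A.le_opNorm x).trans (mul_le_mul_of_nonneg_right h1 (norm_nonneg _))
  have h4 : inner ℂ ((1 - adjoint A ∘L A) x) x = ((‖x‖ ^ 2 - ‖A x‖ ^ 2 : ℝ) : ℂ) := by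
    simp only [sub_apply, one_apply_eq_self, comp_apply, inner_sub_left, adjoint_inner_left,
      inner_self_eq_norm_sq_to_K]
    norm_cast
  rw [h4]
  refine ⟨by rw [RCLike.re_eq_complex_re, Complex.ofReal_re], ?_⟩
  rw [RCLike.re_eq_complex_re, Complex.ofReal_re]
  nlinarith [norm_nonneg (A x)]

end SquareRoots

/-! ### Powers of commuting tuples. -/

section TuplePowers

variable {d : ℕ} {E : Type*} [NormedAddCommGroup E] [InnerProductSpace ℂ E]

theorem tuplePow_zero (S : Fin d → E →L[ℂ] E) : tuplePow S 0 = 1 := by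
  simp [tuplePow]

/-- Frees the power from the fixed order of its factors, so that a single factor can be split off
and the multinomial theorem applies. -/
theorem tuplePow_eq_noncommProd (S : Fin d → E →L[ℂ] E) (hS : ∀ i j, Commute (S i) (S j))
    (α : Fin d → ℕ) : tuplePow S α = Finset.univ.noncommProd (fun i => S i ^ α i)
      fun i _ j _ _ => (hS i j).pow_pow _ _ := by
  have h := Finset.noncommProd_toFinset (List.finRange d) (fun i => S i ^ α i)
    (fun i _ j _ _ => (hS i j).pow_pow _ _) (List.nodup_finRange d)
  rw [tuplePow, List.ofFn_eq_map, ← h]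
  exact Finset.noncommProd_congr (by ext; simp) (fun _ _ => rfl) _

theorem tuplePow_add_single (S : Fin d → E →L[ℂ] E) (hS : ∀ i j, Commute (S i) (S j))
    (α : Fin d → ℕ) (i : Fin d) :
    tuplePow S (α + Pi.single i 1) = tuplePow S α * S i := by
  rw [tuplePow_eq_noncommProd S hS, tuplePow_eq_noncommProd S hS]
  have h1 := Finset.noncommProd_erase_mul Finset.univ (Finset.mem_univ i) (fun j => S j ^ α j)
    fun i _ j _ _ => (hS i j).pow_pow _ _
  have h2 := Finset.noncommProd_erase_mul Finset.univ (Finset.mem_univ i)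
    (fun j => S j ^ (α + Pi.single i 1 : Fin d → ℕ) j) fun i _ j _ _ => (hS i j).pow_pow _ _
  rw [← h1, ← h2, mul_assoc]
  congr 1
  · refine Finset.noncommProd_congr rfl (fun j hj => ?_) _
    simp [Finset.ne_of_mem_erase hj]
  · simp [pow_succ]

theorem sum_smul_pow_eq (S : Fin d → E →L[ℂ] E) (hS : ∀ i j, Commute (S i) (S j))
    (z : Fin d → ℂ) (n : ℕ) :
    (∑ i, z i • S i) ^ n = ∑ α ∈ Finset.piAntidiag Finset.univ n,
      ((Nat.multinomial Finset.univ α : ℂ) * ∏ i, z i ^ α i) • tuplePow S α := by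
  have hc (i j : Fin d) : Commute (z i • S i) (z j • S j) :=
    ((hS i j).smul_left _).smul_right _
  rw [Finset.sum_pow_eq_sum_piAntidiag_of_commute _ _ fun i _ j _ _ => hc i j]
  refine Finset.sum_congr rfl fun α _ => ?_
  have h1 : tuplePow (fun i => z i • S i) α = (∏ i, z i ^ α i) • tuplePow S α := by
    have hl (s : List (Fin d)) : (s.map fun i => (z i • S i) ^ α i).prod =
        (s.map fun i => z i ^ α i).prod • (s.map fun i => S i ^ α i).prod := by
      induction s with
      | nil => simp
      | cons i s ih =>
        rw [List.map_cons, List.map_cons, List.map_cons, List.prod_cons, List.prod_cons,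
          List.prod_cons, ih, smul_pow, smul_mul_smul_comm]
    rw [tuplePow, tuplePow, List.ofFn_eq_map, List.ofFn_eq_map, hl, ← List.ofFn_eq_map,
      List.prod_ofFn]
  rw [← tuplePow_eq_noncommProd _ hc, h1, mul_smul, ← nsmul_eq_mul, Nat.cast_smul_eq_nsmul]

/-- If `L` is invariant under the tuple `S`, then `S^α` maps `L` into `∑ S_i L` for `α ≠ 0`. -/
theorem tuplePow_mem_iSup_map (S : Fin d → E →L[ℂ] E) (L : Submodule ℂ E)
    (hL : ∀ i, ∀ f ∈ L, S i f ∈ L) {α : Fin d → ℕ} (hα : α ≠ 0) {f : E} (hf : f ∈ L) :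
    tuplePow S α f ∈ ⨆ i, L.map (S i).toLinearMap := by
  have hpow (i : Fin d) (n : ℕ) : ∀ g ∈ L, (S i ^ n) g ∈ L := by
    induction n with
    | zero => exact fun g hg => hg
    | succ n ih => intro g hg; rw [pow_succ']; exact hL i _ (ih g hg)
  have hl (s : List (Fin d)) : (s.map fun i => S i ^ α i).prod f ∈ L ∧
      ((∃ i ∈ s, α i ≠ 0) → (s.map fun i => S i ^ α i).prod f ∈
        ⨆ i, L.map (S i).toLinearMap) := by
    induction s with
    | nil => exact ⟨hf, by simp⟩
    | cons i s ih =>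
      rw [List.map_cons, List.prod_cons]
      refine ⟨hpow i _ _ ih.1, fun h => ?_⟩
      rcases Nat.eq_zero_or_eq_succ_pred (α i) with h0 | h0
      · rw [h0, pow_zero, one_mul]
        refine ih.2 ?_
        obtain ⟨j, hj, hj'⟩ := h
        rcases List.mem_cons.1 hj with rfl | hj
        · exact absurd h0 hj'
        · exact ⟨j, hj, hj'⟩
      · rw [h0, pow_succ']
        exact Submodule.mem_iSup_of_mem i ⟨_, hpow i _ _ ih.1, rfl⟩
  rw [tuplePow, List.ofFn_eq_map]
  refine (hl _).2 ?_
  obtain ⟨i, hi⟩ := Function.ne_iff.1 hα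
  exact ⟨i, by simp, hi⟩

end TuplePowers

/-! ### Arithmetic of the weights a_{|α|} γ_α. -/

theorem multinomial_add_single {d : ℕ} (α : Fin d → ℕ) (i : Fin d) :
    (α i + 1) * Nat.multinomial Finset.univ (α + Pi.single i 1) =
      (∑ j, α j + 1) * Nat.multinomial Finset.univ α := by
  have h1 := Nat.multinomial_spec Finset.univ α
  have h2 := Nat.multinomial_spec Finset.univ (α + Pi.single i 1)
  have h3 : ∏ j, ((α + Pi.single i 1 : Fin d → ℕ) j).factorial =
      (α i + 1) * ∏ j, (α j).factorial := by
    rw [← Finset.mul_prod_erase _ _ (Finset.mem_univ i),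
      ← Finset.mul_prod_erase Finset.univ (fun j => (α j).factorial) (Finset.mem_univ i),
      ← mul_assoc]
    congr 1
    · simp [Nat.factorial_succ]
    · refine Finset.prod_congr rfl fun j hj => ?_
      simp [Finset.ne_of_mem_erase hj]
  have h4 : ∑ j, (α + Pi.single i 1 : Fin d → ℕ) j = ∑ j, α j + 1 := by
    simp [Finset.sum_add_distrib]
  rw [h3, h4, Nat.factorial_succ, ← h1] at h2
  apply Nat.eq_of_mul_eq_mul_left (Finset.prod_pos fun j _ => Nat.factorial_pos (α j))
  linarith

theorem KernelSeq.wt_zero (κ : KernelSeq) {d : ℕ} : κ.wt (0 : Fin d → ℕ) = 1 := by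
  have h := Nat.multinomial_spec (Finset.univ : Finset (Fin d)) 0
  simp only [Pi.zero_apply, Nat.factorial_zero, Finset.prod_const_one, one_mul,
    Finset.sum_const_zero] at h
  simp [wt, κ.a_zero, h]

/-- This explains the choice of Δ: its ratio a_{n+1}/a_n cancels the kernel coefficients in the
weight quotient of M_{z_i}^*, and only the combinatorial factor (α_i + 1)/(|α| + 1) survives. -/
theorem KernelSeq.wt_add_single (κ : KernelSeq) {d : ℕ} (α : Fin d → ℕ) (i : Fin d) :
    κ.a (∑ j, α j + 1) / κ.a (∑ j, α j) * κ.wt α =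
      (α i + 1) / (∑ j, α j + 1 : ℕ) * κ.wt (α + Pi.single i 1) := by
  have h1 : ((α i + 1 : ℕ) : ℝ) * Nat.multinomial Finset.univ (α + Pi.single i 1) =
      (∑ j, α j + 1 : ℕ) * Nat.multinomial Finset.univ α := by
    exact_mod_cast multinomial_add_single α i
  have h4 : ∑ j, (α + Pi.single i 1 : Fin d → ℕ) j = ∑ j, α j + 1 := by
    simp [Finset.sum_add_distrib]
  have h5 := (κ.a_pos (∑ j, α j)).ne'
  have h6 : ((∑ j, α j + 1 : ℕ) : ℝ) ≠ 0 := by positivity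
  rw [wt, wt, h4, div_mul_eq_mul_div, div_mul_eq_mul_div, div_eq_div_iff h5 h6]
  push_cast at h1 ⊢
  linear_combination (-(κ.a (∑ j, α j + 1) * κ.a (∑ j, α j))) * h1

/-! ### The decomposition f = f(0) + Σ M_{z_i} Δ M_{z_i}^* f in H_K(E). -/

namespace HK

variable {κ : KernelSeq} {d : ℕ} {E : Type*} [NormedAddCommGroup E] [InnerProductSpace ℂ E]

theorem seq_backShift (i : Fin d) (f : HK κ d E) (α : Fin d → ℕ) :
    seq (backShift κ E i f) α =
      ((Real.sqrt (κ.wt α / κ.wt (α + Pi.single i 1)) : ℝ) : ℂ) • seq f (α + Pi.single i 1) := rfl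

theorem coeff_backShift (i : Fin d) (f : HK κ d E) (α : Fin d → ℕ) :
    coeff (backShift κ E i f) α =
      ((κ.wt α / κ.wt (α + Pi.single i 1) : ℝ) : ℂ) • coeff f (α + Pi.single i 1) := by
  rw [coeff, coeff, seq_backShift, smul_smul, smul_smul, ← Complex.ofReal_mul,
    ← Complex.ofReal_mul]
  congr 2
  have h1 := Real.mul_self_sqrt (κ.wt_pos α).le
  have h2 := Real.mul_self_sqrt (κ.wt_pos (α + Pi.single i 1)).le
  have h3 := (Real.sqrt_pos.2 (κ.wt_pos (α + Pi.single i 1))).ne'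
  rw [Real.sqrt_div (κ.wt_pos α).le]
  nth_rw 3 [← h1]
  nth_rw 2 [← h2]
  field_simp

variable [CompleteSpace E]

/-- The centre of the unit ball. -/
def origin (d : ℕ) : UBall d := ⟨0, by simp⟩

theorem apply_origin (f : HK κ d E) : f (origin d) = coeff f 0 := by
  refine (hasSum_apply f (origin d)).unique ?_
  have h := hasSum_single (f := fun α : Fin d → ℕ => (∏ i, (origin d).1 i ^ α i) • coeff f α) 0
    fun α hα => by
      obtain ⟨i, hi⟩ := Function.ne_iff.1 hα
      have h0 : ∏ i, (origin d).1 i ^ α i = 0 :=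
        Finset.prod_eq_zero (Finset.mem_univ i) (by
          change (0 : ℂ) ^ α i = 0
          exact zero_pow hi)
      rw [h0, zero_smul]
  simpa using h

variable (κ d) in
/-- The constant function with value `v`. -/
noncomputable def const (v : E) : HK κ d E := kvec κ (origin d) v

theorem inner_const (v : E) (f : HK κ d E) :
    inner ℂ (const κ d v) f = inner ℂ v (f (origin d)) :=
  inner_kvec _ _ _

theorem const_apply (v : E) (z : UBall d) : const κ d v z = v := by
  have hk : κ.k 0 = 1 := by
    rw [KernelSeq.k, tsum_eq_single 0 fun n hn => by simp [hn]]
    simp [κ.a_zero]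
  have h : ∑ i, z.1 i * star ((origin d).1 i) = 0 :=
    Finset.sum_eq_zero fun i _ => by
      change z.1 i * star (0 : ℂ) = 0
      simp
  rw [const, ← kerFun_eq, RKHS.kerFun_apply, kernel_eq, h, hk]
  simp

theorem backShift_const (i : Fin d) (v : E) : backShift κ E i (const κ d v) = 0 := by
  rw [const, backShift_kvec]
  change star (0 : ℂ) • _ = _
  simp

theorem adjoint_Mz (i : Fin d) :
    ContinuousLinearMap.adjoint (Mz κ E i) = backShift κ E i := by
  rw [Mz, ContinuousLinearMap.adjoint_adjoint]

theorem coeff_Delta_backShift (i : Fin d) (f : HK κ d E) (α : Fin d → ℕ) :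
    coeff (Delta κ d E (backShift κ E i f)) α =
      (((α i + 1) / (∑ j, α j + 1 : ℕ) : ℝ) : ℂ) • coeff f (α + Pi.single i 1) := by
  rw [coeff_Delta, coeff_backShift, smul_smul, ← Complex.ofReal_mul, ← mul_div_assoc,
    κ.wt_add_single, mul_div_cancel_right₀ _ (κ.wt_pos _).ne']

theorem hasSum_Mz_Delta_backShift (i : Fin d) (f : HK κ d E) (z : UBall d) :
    HasSum (fun β : Fin d → ℕ => (((β i) / (∑ j, β j : ℕ) : ℝ) : ℂ) •
      (∏ j, z.1 j ^ β j) • coeff f β) (Mz κ E i (Delta κ d E (backShift κ E i f)) z) := by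
  have hinj : Function.Injective fun α : Fin d → ℕ => α + Pi.single i 1 := add_left_injective _
  rw [← hinj.hasSum_iff, Mz_apply]
  · refine ((hasSum_apply (Delta κ d E (backShift κ E i f)) z).const_smul (z.1 i)).congr_fun
      fun α => ?_
    have h1 : ∏ j, z.1 j ^ (α + Pi.single i 1 : Fin d → ℕ) j = z.1 i * ∏ j, z.1 j ^ α j := by
      simp only [Pi.add_apply, pow_add, Finset.prod_mul_distrib]
      rw [Finset.prod_eq_single i (f := fun j => z.1 j ^ (Pi.single i 1 : Fin d → ℕ) j)]
        <;> simp +contextual [mul_comm]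
    have h4 : ∑ j, (α + Pi.single i 1 : Fin d → ℕ) j = ∑ j, α j + 1 := by
      simp [Finset.sum_add_distrib]
    rw [Function.comp_apply, h1, h4, coeff_Delta_backShift, smul_smul, smul_smul, smul_smul]
    congr 1
    simp only [Pi.add_apply, Pi.single_eq_same]
    push_cast
    ring
  -- The exponents outside the image of α ↦ α + e_i are those with β_i = 0, where the factor β_i/|β|
  -- vanishes; for β = 0 this uses 0/0 = 0.
  · intro β hβ
    have h0 : β i = 0 := by
      by_contra h
      refine hβ ⟨β - Pi.single i 1, ?_⟩
      refine tsub_add_cancel_of_le fun j => ?_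
      rcases eq_or_ne j i with rfl | hj
      · simpa using Nat.one_le_iff_ne_zero.2 h
      · simp [hj]
    simp [h0]

/-- `1 - ∑ M_{z_i} Δ M_{z_i}^*` is the projection onto the constants. -/
theorem eq_const_add_sum (f : HK κ d E) :
    f = const κ d (f (origin d)) + ∑ i, Mz κ E i (Delta κ d E (backShift κ E i f)) := by
  refine RKHS.ext fun z => ?_
  have h1 := hasSum_sum fun (i : Fin d) (_ : i ∈ Finset.univ) => hasSum_Mz_Delta_backShift i f z
  have h2 : HasSum (fun β : Fin d → ℕ => if β = 0 then coeff f 0 else 0) (coeff f 0) :=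
    hasSum_ite_eq 0 _
  have h3 := h2.add h1
  have h4 : (∑ i, Mz κ E i (Delta κ d E (backShift κ E i f))) z =
      ∑ i, Mz κ E i (Delta κ d E (backShift κ E i f)) z := by
    change RKHS.coeCLM ℂ _ z = _
    rw [map_sum, Finset.sum_apply]
    rfl
  rw [RKHS.coe_add, Pi.add_apply, const_apply, h4, apply_origin]
  refine (hasSum_apply f z).unique (h3.congr_fun fun β => ?_)
  rw [← Finset.sum_smul]
  split_ifs with h
  -- At β = 0 all the fractions are 0/0 = 0, so the constant alone supplies this coefficient.
  · subst h; simp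
  · have h5 : ((∑ j, β j : ℕ) : ℂ) ≠ 0 := by
      refine Nat.cast_ne_zero.2 fun h6 => h (funext fun i => ?_)
      exact (Finset.sum_eq_zero_iff.1 h6) i (Finset.mem_univ i)
    have h6 : ∑ i, (((β i) / (∑ j, β j : ℕ) : ℝ) : ℂ) = 1 := by
      simp only [Complex.ofReal_div, Complex.ofReal_natCast]
      rw [← Finset.sum_div, ← Nat.cast_sum, div_self h5]
    rw [h6, one_smul, zero_add]

/-- M_{z_k}^* annihilates the constant term of the decomposition. Thus M_z^* M_z (⊕Δ) fixes every
vector in the range of M_z^*. -/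
theorem backShift_sum_Mz_Delta (k : Fin d) (f : HK κ d E) :
    backShift κ E k (∑ i, Mz κ E i (Delta κ d E (backShift κ E i f))) = backShift κ E k f := by
  conv_rhs => rw [eq_const_add_sum f, map_add, backShift_const, zero_add]

/-- Obtained by pairing the decomposition with f. For f = W_T y the two terms become ‖T̃y‖² and
‖D_T̃ y‖². -/
theorem norm_sq_eq (f : HK κ d E) :
    ‖f‖ ^ 2 = ‖f (origin d)‖ ^ 2 +
      ∑ i, (inner ℂ (Delta κ d E (backShift κ E i f)) (backShift κ E i f)).re := by
  have h1 : inner ℂ f f = inner ℂ (f (origin d)) (f (origin d)) +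
      ∑ i, inner ℂ (Delta κ d E (backShift κ E i f)) (backShift κ E i f) := by
    refine (congrArg (fun g => inner ℂ g f) (eq_const_add_sum f)).trans ?_
    rw [inner_add_left, inner_const, sum_inner]
    congr 1
    refine Finset.sum_congr rfl fun i _ => ?_
    rw [← adjoint_Mz, ContinuousLinearMap.adjoint_inner_right]
  have h2 := congrArg Complex.re h1
  rw [Complex.add_re, Complex.re_sum, inner_self_eq_norm_sq_to_K, inner_self_eq_norm_sq_to_K] at h2
  exact_mod_cast h2

end HK

/-! ### The canonical dilation, the space M and the contraction T̃. -/

namespace PureKContraction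

variable {κ : KernelSeq} {d : ℕ} {H : Type*} [NormedAddCommGroup H] [InnerProductSpace ℂ H]
  [CompleteSpace H] (S : PureKContraction κ d H)

open ContinuousLinearMap (adjoint adjoint_inner_left adjoint_inner_right)

theorem commute_adjoint (i k : Fin d) : Commute (adjoint (S.T i)) (adjoint (S.T k)) :=
  (S.isKContraction.1 i k).star_star

theorem adjPow_add_single (α : Fin d → ℕ) (i : Fin d) (h : H) :
    S.adjPow (α + Pi.single i 1) h = S.adjPow α (adjoint (S.T i) h) := by
  rw [adjPow, tuplePow_add_single _ S.commute_adjoint]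
  rfl

theorem C_nonneg : 0 ≤ S.C := CFC.sqrt_nonneg _

theorem inner_C (x y : H) : inner ℂ (S.C x) y = inner ℂ x (S.C y) := by
  have h : adjoint S.C = S.C := (IsSelfAdjoint.of_nonneg S.C_nonneg).star_eq
  rw [← adjoint_inner_right, h]

theorem seq_j (h : H) (α : Fin d → ℕ) :
    HK.seq (S.j h) α = ((Real.sqrt (κ.wt α) : ℝ) : ℂ) • S.C' (S.adjPow α h) := rfl

/-- The canonical dilation intertwines `T^*` and `M_z^*`. -/
theorem j_adjoint (i : Fin d) (h : H) :
    S.j (adjoint (S.T i) h) = HK.backShift κ S.defectSpace i (S.j h) := by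
  apply HK.seq.injective
  refine lp.ext (funext fun α => ?_)
  rw [HK.seq_backShift, S.seq_j, S.seq_j, S.adjPow_add_single, smul_smul, ← Complex.ofReal_mul,
    ← Real.sqrt_mul (div_pos (κ.wt_pos _) (κ.wt_pos _)).le, div_mul_cancel₀ _ (κ.wt_pos _).ne']

/-- The adjoint `j^*` of the canonical dilation. -/
noncomputable def jAdj : HK κ d S.defectSpace →L[ℂ] H := adjoint S.j.toContinuousLinearMap

theorem inner_jAdj (f : HK κ d S.defectSpace) (h : H) :
    inner ℂ (S.jAdj f) h = inner ℂ f (S.j h) :=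
  adjoint_inner_left S.j.toContinuousLinearMap h f

theorem jAdj_j (h : H) : S.jAdj (S.j h) = h := by
  refine ext_inner_right ℂ fun y => ?_
  rw [inner_jAdj, LinearIsometry.inner_map_map]

theorem DeltaT_apply (h : H) :
    S.DeltaT h = S.jAdj (HK.Delta κ d S.defectSpace (S.j h)) := rfl

theorem jAdj_Mz (i : Fin d) (f : HK κ d S.defectSpace) :
    S.jAdj (HK.Mz κ S.defectSpace i f) = S.T i (S.jAdj f) := by
  refine ext_inner_right ℂ fun h => ?_
  rw [inner_jAdj, ← adjoint_inner_right, HK.adjoint_Mz, ← j_adjoint, ← inner_jAdj,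
    adjoint_inner_right]

theorem j_apply_origin (h : H) : S.j h (HK.origin d) = S.C' h := by
  rw [HK.apply_origin, coeff_j, κ.wt_zero, adjPow, tuplePow_zero]
  simp

theorem jAdj_const (v : S.defectSpace) : S.jAdj (HK.const κ d v) = S.C v := by
  refine ext_inner_right ℂ fun h => ?_
  rw [inner_jAdj, HK.inner_const, j_apply_origin, inner_C]
  rfl

theorem mem_M (f : HK κ d S.defectSpace) : f ∈ S.M ↔ S.jAdj f = 0 := by
  rw [M, Submodule.mem_orthogonal']
  constructor
  · intro h
    refine ext_inner_right ℂ fun y => ?_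
    rw [inner_jAdj, inner_zero_left]
    exact h _ ⟨y, rfl⟩
  · rintro h _ ⟨y, rfl⟩
    change inner ℂ f (S.j y) = 0
    rw [← inner_jAdj, h, inner_zero_left]

theorem Mz_mem_M (i : Fin d) (f : HK κ d S.defectSpace) (hf : f ∈ S.M) :
    HK.Mz κ S.defectSpace i f ∈ S.M := by
  rw [mem_M] at hf ⊢
  rw [jAdj_Mz, hf, map_zero]

theorem M_orthogonal : S.Mᗮ = S.j.toLinearMap.range := by
  have h : IsClosed (S.j.toLinearMap.range : Set (HK κ d S.defectSpace)) := by
    have := S.j.isometry.isClosedEmbedding.isClosed_range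
    rwa [LinearMap.coe_range]
  rw [M, Submodule.orthogonal_orthogonal_eq_closure]
  exact h.submodule_topologicalClosure_eq

/-- Orthogonality to M_{z_i} M means M_{z_i}^* f ∈ M^⊥, and M^⊥ = Im j because the range of an
isometry on a complete space is closed. -/
theorem mem_wanderingSubspace_M (f : HK κ d S.defectSpace) :
    f ∈ wanderingSubspace (HK.Mz κ S.defectSpace) S.M ↔
      S.jAdj f = 0 ∧ ∀ i, ∃ x, S.j x = HK.backShift κ S.defectSpace i f := by
  rw [wanderingSubspace, Submodule.mem_inf, mem_M, ← Submodule.iInf_orthogonal, Submodule.mem_iInf]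
  refine and_congr_right fun _ => forall_congr' fun i => ?_
  have h1 : HK.backShift κ S.defectSpace i f ∈ S.Mᗮ ↔
      ∃ x, S.j x = HK.backShift κ S.defectSpace i f := by
    rw [M_orthogonal]; rfl
  rw [← h1, Submodule.mem_orthogonal, Submodule.mem_orthogonal, ← HK.adjoint_Mz]
  constructor
  · intro h g hg
    rw [adjoint_inner_right]
    exact h _ ⟨g, hg, rfl⟩
  · rintro h _ ⟨g, hg, rfl⟩
    have := h g hg
    rwa [adjoint_inner_right] at this

/-- Δ_T enters because the adjoint is taken between two different scalar products, and that of H̃ is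
⟨Δ_T x, y⟩. -/
theorem adjoint_IT (y : S.HTilde) :
    adjoint (S.IT : H →L[ℂ] S.HTilde) y = S.DeltaT (S.IT.symm y) := by
  refine ext_inner_right ℂ fun h => ?_
  rw [adjoint_inner_left]
  rfl

theorem rowTilde_apply (y : PiLp 2 fun _ : Fin d => S.HTilde) :
    S.rowTilde y = ∑ i, S.T i (S.DeltaT (S.IT.symm (y i))) := by
  rw [rowTilde, rowOp_apply]
  exact Finset.sum_congr rfl fun i _ => congrArg (S.T i) (S.adjoint_IT (y i))

theorem adjoint_rowTilde_apply (h : H) (i : Fin d) :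
    adjoint S.rowTilde h i = S.IT (adjoint (S.T i) h) := by
  have h1 : adjoint S.rowTilde h = WithLp.toLp 2 fun i => S.IT (adjoint (S.T i) h) := by
    refine ext_inner_right ℂ fun y => ?_
    rw [adjoint_inner_left, rowTilde_apply, PiLp.inner_apply, inner_sum]
    refine Finset.sum_congr rfl fun k _ => ?_
    rw [← adjoint_IT, ← adjoint_inner_left, adjoint_inner_right]
    rfl
  rw [h1]

/-- Compressing the decomposition of jh by j^* gives h = C²h + Σ_i T_i Δ_T T_i^* h, and the sum is
T̃T̃^* h. -/
theorem rowTilde_comp_adjoint : S.rowTilde ∘L adjoint S.rowTilde = 1 - S.C * S.C := by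
  ext h
  rw [ContinuousLinearMap.comp_apply, rowTilde_apply]
  have h1 := congrArg S.jAdj (HK.eq_const_add_sum (S.j h))
  rw [map_add, jAdj_j, jAdj_const, j_apply_origin, map_sum] at h1
  have h2 : ∑ i, S.T i (S.DeltaT (S.IT.symm (adjoint S.rowTilde h i))) = ∑ i,
      S.jAdj (HK.Mz κ S.defectSpace i (HK.Delta κ d S.defectSpace
        (HK.backShift κ S.defectSpace i (S.j h)))) := by
    refine Finset.sum_congr rfl fun i _ => ?_
    rw [adjoint_rowTilde_apply, ContinuousLinearEquiv.symm_apply_apply, jAdj_Mz, DeltaT_apply,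
      j_adjoint]
  rw [h2]
  exact eq_sub_of_add_eq' h1.symm

theorem one_sub_adjoint_rowTilde_nonneg : 0 ≤ 1 - adjoint S.rowTilde ∘L S.rowTilde := by
  refine one_sub_adjoint_comp_nonneg _ ?_
  rw [rowTilde_comp_adjoint, sub_sub_cancel, S.C_mul_C]
  obtain ⟨P, hP, hlim⟩ := S.isKContraction.2
  rw [recipK_eq hlim]
  exact (ContinuousLinearMap.nonneg_iff_isPositive P).2 hP

theorem defectTilde_sq (y : PiLp 2 fun _ : Fin d => S.HTilde) :
    S.defectTilde (S.defectTilde y) = y - adjoint S.rowTilde (S.rowTilde y) :=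
  DFunLike.congr_fun (defectOp_mul_self _ S.one_sub_adjoint_rowTilde_nonneg) y

theorem inner_defectTilde (x y : PiLp 2 fun _ : Fin d => S.HTilde) :
    inner ℂ (S.defectTilde x) y = inner ℂ x (S.defectTilde y) := by
  rw [← adjoint_inner_right]
  exact congrArg (fun A => inner ℂ x (A y)) (adjoint_defectOp S.rowTilde)

/-- C is a positive square root of 1 - T̃T̃^*, so it plays the role of the defect operator of T̃^*.
-/
theorem defectTilde_adjoint_rowTilde (h : H) :
    S.defectTilde (adjoint S.rowTilde h) = adjoint S.rowTilde (S.C h) :=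
  DFunLike.congr_fun (defectOp_comp_adjoint S.rowTilde S.C_nonneg S.rowTilde_comp_adjoint
    S.one_sub_adjoint_rowTilde_nonneg) h

theorem rowTilde_defectTilde (y : PiLp 2 fun _ : Fin d => S.HTilde) :
    S.rowTilde (S.defectTilde y) = S.C (S.rowTilde y) := by
  refine ext_inner_right ℂ fun h => ?_
  rw [← adjoint_inner_right, inner_defectTilde, defectTilde_adjoint_rowTilde, adjoint_inner_right,
    inner_C]

theorem rowTilde_adjoint_rowTilde (h : H) :
    S.rowTilde (adjoint S.rowTilde h) = h - S.C (S.C h) :=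
  DFunLike.congr_fun S.rowTilde_comp_adjoint h

theorem norm_sq_rowTilde_add (y : PiLp 2 fun _ : Fin d => S.HTilde) :
    ‖S.rowTilde y‖ ^ 2 + ‖S.defectTilde y‖ ^ 2 = ‖y‖ ^ 2 := by
  have h : inner ℂ (S.rowTilde y) (S.rowTilde y) + inner ℂ (S.defectTilde y) (S.defectTilde y) =
      inner ℂ y y := by
    rw [inner_defectTilde, defectTilde_sq, ← adjoint_inner_right, inner_sub_right,
      add_sub_cancel]
  simp only [inner_self_eq_norm_sq_to_K] at h
  exact_mod_cast h

end PureKContraction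

/-! ### Growth of the coefficients a_n. -/

namespace KernelSeq

variable (κ : KernelSeq)

/-- The ratios `aₙ / aₙ₊₁` cannot converge to a limit below `1`. -/
theorem one_le_of_tendsto_ratio {R : ℝ}
    (hR : Tendsto (fun n => κ.a n / κ.a (n + 1)) atTop (𝓝 R)) : 1 ≤ R := by
  have hR0 : 0 < R := κ.ratio_inf_pos.trans_le <| ge_of_tendsto' hR fun n =>
    ciInf_le ⟨0, by rintro _ ⟨m, rfl⟩; exact (div_pos (κ.a_pos _) (κ.a_pos _)).le⟩ n
  by_contra! h
  obtain ⟨ρ, h1, h2⟩ := exists_between h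
  have hρ : 0 < ρ := hR0.trans h1
  have h3 : Summable fun n => κ.a n * ρ ^ n := by
    have h4 := κ.summable_disc (ρ : ℂ) (by rwa [Complex.norm_real, Real.norm_of_nonneg hρ.le])
    exact_mod_cast h4
  -- With R < ρ < 1, the terms a_n ρ^n have ratio tending to ρ/R > 1, although k converges at ρ.
  refine not_summable_of_ratio_test_tendsto_gt_one (l := ρ / R) ((one_lt_div hR0).2 h1) ?_ h3
  refine (tendsto_const_nhds.div hR hR0.ne').congr fun n => ?_
  have ha := κ.a_pos n
  have hb := κ.a_pos (n + 1)
  rw [Real.norm_of_nonneg (by positivity), Real.norm_of_nonneg (by positivity), pow_succ, Pi.div_apply]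
  field_simp

/-- The backward growth of the coefficients over `n` steps is at most geometric, at a rate that
is as close to the limit of the ratios as needed. -/
theorem exists_ratio_bound {R Q : ℝ} (hR : Tendsto (fun n => κ.a n / κ.a (n + 1)) atTop (𝓝 R))
    (hQ0 : 0 < Q) (hQ : R < Q) : ∃ w : ℝ, 0 < w ∧ ∀ m n, κ.a m ≤ w * Q ^ n * κ.a (m + n) := by
  obtain ⟨N, hN⟩ := eventually_atTop.1 (hR.eventually_lt_const hQ)
  -- From index N on every ratio is below Q. Each earlier ratio is at most sQ, so at most N extra
  -- factors s occur. The truncated difference N - m counts those still ahead of index m.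
  set s : ℝ := max 1 ((⨆ m, κ.a m / κ.a (m + 1)) / Q) with hs
  have hs1 : 1 ≤ s := le_max_left _ _
  have hs0 : 0 < s := zero_lt_one.trans_le hs1
  have hstep (m : ℕ) : κ.a m / κ.a (m + 1) * s ^ (N - (m + 1)) ≤ s ^ (N - m) * Q := by
    rcases le_or_gt N m with h | h
    · rw [Nat.sub_eq_zero_of_le h, Nat.sub_eq_zero_of_le (h.trans (Nat.le_succ m)), pow_zero,
        mul_one, one_mul]
      exact (hN m h).le
    · have h1 : N - m = (N - (m + 1)) + 1 := by omega
      have h2 : κ.a m / κ.a (m + 1) ≤ s * Q := by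
        refine (κ.ratio_le m).trans ?_
        rw [← div_le_iff₀ hQ0]
        exact le_max_right _ _
      rw [h1, pow_succ]
      nlinarith [pow_pos hs0 (N - (m + 1))]
  have hmain (n : ℕ) : ∀ m, κ.a m ≤ s ^ (N - m) * Q ^ n * κ.a (m + n) := by
    induction n with
    | zero =>
      intro m
      rw [pow_zero, mul_one, add_zero]
      exact le_mul_of_one_le_left (κ.a_pos m).le (one_le_pow₀ hs1)
    | succ n ih =>
      intro m
      have h0 := κ.a_pos (m + 1 + n)
      calc κ.a m = κ.a m / κ.a (m + 1) * κ.a (m + 1) :=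
            (div_mul_cancel₀ _ (κ.a_pos (m + 1)).ne').symm
        _ ≤ κ.a m / κ.a (m + 1) * (s ^ (N - (m + 1)) * Q ^ n * κ.a (m + 1 + n)) :=
            mul_le_mul_of_nonneg_left (ih (m + 1)) (div_pos (κ.a_pos _) (κ.a_pos _)).le
        _ = (κ.a m / κ.a (m + 1) * s ^ (N - (m + 1))) * (Q ^ n * κ.a (m + 1 + n)) := by ring
        _ ≤ (s ^ (N - m) * Q) * (Q ^ n * κ.a (m + 1 + n)) :=
            mul_le_mul_of_nonneg_right (hstep m) (by positivity)
        _ = s ^ (N - m) * Q ^ (n + 1) * κ.a (m + (n + 1)) := by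
            rw [show m + (n + 1) = m + 1 + n by ring]; ring
  refine ⟨s ^ N, pow_pos hs0 N, fun m n => (hmain n m).trans ?_⟩
  have h0 := κ.a_pos (m + n)
  have h1 : s ^ (N - m) ≤ s ^ N := pow_le_pow_right₀ hs1 (Nat.sub_le _ _)
  gcongr

/-- Take B_n = w(R/r)^n, with R the limit of the ratios. The successive terms of the series then
have ratio tending to √(R/r)·r/R = √(r/R), which is below 1 because r < 1 ≤ R. -/
theorem exists_summable_bound {r : ℝ} (hr0 : 0 < r) (hr : r < 1) : ∃ B : ℕ → ℝ,
    (∀ n, 0 ≤ B n) ∧ (∀ m n, κ.a m ≤ B n * κ.a (m + n)) ∧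
      Summable fun n => κ.a (n + 1) * Real.sqrt (B n) * r ^ n := by
  obtain ⟨R, hR⟩ := κ.ratio_tendsto
  have hR1 := κ.one_le_of_tendsto_ratio hR
  have hR0 : 0 < R := zero_lt_one.trans_le hR1
  have hQ0 : 0 < R / r := div_pos hR0 hr0
  have hQ : R < R / r := by rw [lt_div_iff₀ hr0]; nlinarith
  obtain ⟨w, hw, hb⟩ := κ.exists_ratio_bound hR hQ0 hQ
  refine ⟨fun n => w * (R / r) ^ n, fun n => by positivity, hb, ?_⟩
  have hlt : Real.sqrt (R / r) * r / R < 1 := by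
    rw [div_lt_one hR0]
    have h1 := Real.sq_sqrt hQ0.le
    refine lt_of_pow_lt_pow_left₀ 2 hR0.le ?_
    rw [mul_pow, h1]
    have h2 : R / r * r ^ 2 = R * r := by field_simp
    rw [h2]
    nlinarith
  have hpos (n : ℕ) : 0 < κ.a (n + 1) * Real.sqrt (w * (R / r) ^ n) * r ^ n := by
    have := κ.a_pos (n + 1)
    positivity
  refine summable_of_ratio_test_tendsto_lt_one hlt (Eventually.of_forall fun n => (hpos n).ne') ?_
  have h1 : Tendsto (fun n => Real.sqrt (R / r) * r / (κ.a (n + 1) / κ.a (n + 2))) atTop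
      (𝓝 (Real.sqrt (R / r) * r / R)) :=
    tendsto_const_nhds.div (hR.comp (tendsto_add_atTop_nat 1)) hR0.ne'
  refine h1.congr fun n => ?_
  rw [Real.norm_of_nonneg (hpos n).le, Real.norm_of_nonneg (hpos (n + 1)).le,
    Real.sqrt_mul hw.le, Real.sqrt_mul hw.le, pow_succ (R / r), Real.sqrt_mul (by positivity),
    pow_succ r]
  have ha := κ.a_pos (n + 1)
  have hb := κ.a_pos (n + 2)
  have h2 : 0 < Real.sqrt ((R / r) ^ n) := Real.sqrt_pos.2 (by positivity)
  have h3 : 0 < Real.sqrt w := Real.sqrt_pos.2 hw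
  generalize Real.sqrt ((R / r) ^ n) = u at *
  generalize Real.sqrt (R / r) = v at *
  field_simp

end KernelSeq

/-! ### Norm convergence and analyticity of F(ZT^*) on the ball. -/

theorem norm_sum_smul_sq_le {ι E : Type*} [Fintype ι] [NormedAddCommGroup E] [NormedSpace ℂ E]
    (z : EuclideanSpace ℂ ι) (u : ι → E) :
    ‖∑ i, z i • u i‖ ^ 2 ≤ ‖z‖ ^ 2 * ∑ i, ‖u i‖ ^ 2 := by
  rw [EuclideanSpace.norm_sq_eq]
  refine (pow_le_pow_left₀ (norm_nonneg _) (norm_sum_le _ _) 2).trans ?_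
  simp only [norm_smul]
  exact Finset.sum_mul_sq_le_sq_mul_sq _ _ _

namespace PureKContraction

variable {κ : KernelSeq} {d : ℕ} {H : Type*} [NormedAddCommGroup H] [InnerProductSpace ℂ H]
  [CompleteSpace H] (S : PureKContraction κ d H)

open ContinuousLinearMap (adjoint adjoint_inner_left adjoint_inner_right)

/-- The quadratic form `⟨σ_Tᵐ((1/K)(T)) h, h⟩`. -/
noncomputable def defectForm (m : ℕ) (h : H) : ℝ :=
  ∑ α ∈ Finset.piAntidiag Finset.univ m,
    (Nat.multinomial Finset.univ α : ℝ) * ‖S.C (S.adjPow α h)‖ ^ 2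

theorem defectForm_nonneg (m : ℕ) (h : H) : 0 ≤ S.defectForm m h :=
  Finset.sum_nonneg fun α _ => by positivity

/-- Peeling off the outermost σ_T moves one T_i^* onto each of the two vectors in the form. -/
theorem defectForm_succ (m : ℕ) (h : H) :
    S.defectForm (m + 1) h = ∑ i, S.defectForm m (adjoint (S.T i) h) := by
  have h1 := S.inner_sigma (m + 1) h
  rw [Function.iterate_succ_apply'] at h1
  have h2 : inner ℂ h (sigmaMap S.T ((sigmaMap S.T)^[m] (recipK κ S.T)) h) =
      ∑ i, inner ℂ (adjoint (S.T i) h) ((sigmaMap S.T)^[m] (recipK κ S.T) (adjoint (S.T i) h)) := by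
    rw [sigmaMap, sum_apply, inner_sum]
    refine Finset.sum_congr rfl fun i _ => ?_
    rw [adjoint_inner_left]
    rfl
  rw [h2, Finset.sum_congr rfl fun i _ => S.inner_sigma m (adjoint (S.T i) h)] at h1
  exact_mod_cast h1.symm

theorem ZTadj_apply (z : EuclideanSpace ℂ (Fin d)) (h : H) :
    S.ZTadj z h = ∑ i, z i • adjoint (S.T i) h := by
  rw [ZTadj, sum_apply]
  rfl

/-- Cauchy–Schwarz in the index i, applied to C T^{*α} Σ_i z_i T_i^* h for each α separately. -/
theorem defectForm_ZTadj_le (m : ℕ) (z : EuclideanSpace ℂ (Fin d)) (h : H) :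
    S.defectForm m (S.ZTadj z h) ≤ ‖z‖ ^ 2 * S.defectForm (m + 1) h := by
  rw [defectForm_succ]
  simp only [defectForm]
  rw [Finset.sum_comm, Finset.mul_sum]
  refine Finset.sum_le_sum fun α _ => ?_
  rw [← Finset.mul_sum, mul_left_comm, ZTadj_apply, map_sum, map_sum]
  refine mul_le_mul_of_nonneg_left ?_ (Nat.cast_nonneg _)
  simp only [map_smul]
  exact norm_sum_smul_sq_le z _

theorem hasSum_defectForm (h : H) : HasSum (fun m => κ.a m * S.defectForm m h) (‖h‖ ^ 2) := by
  refine (hasSum_degree (S.hasSum_norm h)).congr_fun fun m => ?_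
  rw [defectForm, Finset.mul_sum]
  refine Finset.sum_congr rfl fun α hα => ?_
  have : ∑ i, α i = m := by simpa using hα
  rw [KernelSeq.wt, this, mul_assoc]

/-- Products with different points z are needed, and not only powers, because the norm of a
multilinear coefficient of the power series is tested on arbitrary arguments. -/
theorem defectForm_prod_le (l : List (EuclideanSpace ℂ (Fin d))) (h : H) (m : ℕ) :
    S.defectForm m ((l.map S.ZTadj).prod h) ≤
      (l.map norm).prod ^ 2 * S.defectForm (m + l.length) h := by
  induction l generalizing m with
  | nil => simp
  | cons z l ih =>
    rw [List.map_cons, List.map_cons, List.prod_cons, List.prod_cons, List.length_cons, mul_pow,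
      mul_assoc]
    refine (S.defectForm_ZTadj_le m z _).trans ?_
    refine mul_le_mul_of_nonneg_left ((ih (m + 1)).trans_eq ?_) (sq_nonneg _)
    rw [show m + 1 + l.length = m + (l.length + 1) by ring]

/-- Compare ‖·‖² = Σ_m a_m q_m term by term: the product shifts q_m to q_{m+n}, the constant B
replaces a_m by a_{m+n}, and the shifted series is a tail of the series for ‖h‖². -/
theorem norm_prod_ZTadj_le {B : ℝ} (l : List (EuclideanSpace ℂ (Fin d))) (hB0 : 0 ≤ B)
    (hB : ∀ m, κ.a m ≤ B * κ.a (m + l.length)) :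
    ‖(l.map S.ZTadj).prod‖ ≤ Real.sqrt B * (l.map norm).prod := by
  have hp : 0 ≤ (l.map norm).prod := List.prod_nonneg fun x hx => by
    obtain ⟨z, _, rfl⟩ := List.mem_map.1 hx
    exact norm_nonneg z
  refine ContinuousLinearMap.opNorm_le_bound _ (by positivity) fun h => ?_
  refine (sq_le_sq₀ (norm_nonneg _) (by positivity)).1 ?_
  rw [mul_pow, mul_pow, Real.sq_sqrt hB0]
  have h1 := S.hasSum_defectForm ((l.map S.ZTadj).prod h)
  have h2 := S.hasSum_defectForm h
  have h3 : Summable fun m => κ.a (m + l.length) * S.defectForm (m + l.length) h :=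
    h2.summable.comp_injective (add_left_injective l.length)
  have h4 : ∑' m, κ.a (m + l.length) * S.defectForm (m + l.length) h ≤ ‖h‖ ^ 2 := by
    rw [← h2.tsum_eq]
    exact tsum_comp_le_tsum_of_inj h2.summable
      (fun m => mul_nonneg (κ.a_pos m).le (S.defectForm_nonneg m h)) (add_left_injective l.length)
  refine (hasSum_le (fun m => ?_) h1 (h3.hasSum.mul_left (B * (l.map norm).prod ^ 2))).trans
    (mul_le_mul_of_nonneg_left h4 (by positivity))
  have h5 := S.defectForm_nonneg (m + l.length) h
  calc κ.a m * S.defectForm m ((l.map S.ZTadj).prod h)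
      ≤ (B * κ.a (m + l.length)) * ((l.map norm).prod ^ 2 * S.defectForm (m + l.length) h) :=
        mul_le_mul (hB m) (S.defectForm_prod_le l h m) (S.defectForm_nonneg _ _)
          (mul_nonneg hB0 (κ.a_pos _).le)
    _ = _ := by ring

/-- The linear map `z ↦ Z T^*`. -/
noncomputable def ZTadjL : EuclideanSpace ℂ (Fin d) →L[ℂ] (H →L[ℂ] H) :=
  ∑ i, (EuclideanSpace.proj i : EuclideanSpace ℂ (Fin d) →L[ℂ] ℂ).smulRight (adjoint (S.T i))

theorem ZTadjL_apply (z : EuclideanSpace ℂ (Fin d)) : S.ZTadjL z = S.ZTadj z := by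
  rw [ZTadjL, sum_apply, ZTadj]
  rfl

/-- The power series of `z ↦ F(Z T^*)` at the origin. -/
noncomputable def FTSeries : FormalMultilinearSeries ℂ (EuclideanSpace ℂ (Fin d)) (H →L[ℂ] H) :=
  fun n => (κ.a (n + 1) : ℂ) •
    (ContinuousMultilinearMap.mkPiAlgebraFin ℂ n (H →L[ℂ] H)).compContinuousLinearMap
      fun _ => S.ZTadjL

theorem FTSeries_apply (n : ℕ) (v : Fin n → EuclideanSpace ℂ (Fin d)) :
    S.FTSeries n v = (κ.a (n + 1) : ℂ) • ((List.ofFn v).map S.ZTadj).prod := by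
  rw [List.map_ofFn]
  simp only [FTSeries, smul_apply,
    ContinuousMultilinearMap.compContinuousLinearMap_apply,
    ContinuousMultilinearMap.mkPiAlgebraFin_apply, ZTadjL_apply]
  rfl

theorem FTSeries_apply_const (n : ℕ) (z : EuclideanSpace ℂ (Fin d)) :
    (S.FTSeries n fun _ => z) = (κ.a (n + 1) : ℂ) • S.ZTadj z ^ n := by
  rw [FTSeries_apply, List.ofFn_const, List.map_replicate, List.prod_replicate]

theorem FTSeries_sum : S.FTSeries.sum = S.FT := by
  funext z
  exact tsum_congr fun n => S.FTSeries_apply_const n z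

theorem norm_FTSeries_le {B : ℕ → ℝ} (hB0 : ∀ n, 0 ≤ B n)
    (hB : ∀ m n, κ.a m ≤ B n * κ.a (m + n)) (n : ℕ) :
    ‖S.FTSeries n‖ ≤ κ.a (n + 1) * Real.sqrt (B n) := by
  have ha := κ.a_pos (n + 1)
  refine ContinuousMultilinearMap.opNorm_le_bound (by positivity) fun v => ?_
  rw [FTSeries_apply, norm_smul, Complex.norm_real, Real.norm_of_nonneg ha.le, mul_assoc]
  refine mul_le_mul_of_nonneg_left ?_ ha.le
  have h1 := S.norm_prod_ZTadj_le (List.ofFn v) (hB0 n) (by simpa using fun m => hB m n)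
  refine h1.trans_eq ?_
  rw [List.map_ofFn, List.prod_ofFn]
  rfl

theorem one_le_radius_FTSeries : 1 ≤ S.FTSeries.radius := by
  refine ENNReal.le_of_forall_nnreal_lt fun r hr => ?_
  have hr1 : (r : ℝ) < 1 := by exact_mod_cast hr
  -- The coefficient bound needs a positive radius, and r may be 0.
  obtain ⟨ρ, h1, h2⟩ := exists_between hr1
  have hρ : 0 < ρ := r.2.trans_lt h1
  obtain ⟨B, hB0, hB, hs⟩ := κ.exists_summable_bound hρ h2
  refine S.FTSeries.le_radius_of_summable_norm (Summable.of_nonneg_of_le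
    (fun n => by positivity) (fun n => ?_) hs)
  have := κ.a_pos (n + 1)
  exact mul_le_mul (S.norm_FTSeries_le hB0 hB n) (pow_le_pow_left₀ r.2 h1.le n)
    (by positivity) (by positivity)

theorem mem_eball_radius {z : EuclideanSpace ℂ (Fin d)} (hz : z ∈ UBall d) :
    z ∈ Metric.eball (0 : EuclideanSpace ℂ (Fin d)) S.FTSeries.radius := by
  refine Metric.eball_subset_eball S.one_le_radius_FTSeries ?_
  rw [Metric.mem_eball]
  rw [Metric.mem_ball] at hz
  rw [edist_dist, ENNReal.ofReal_lt_one]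
  exact hz

theorem summable_FT {z : EuclideanSpace ℂ (Fin d)} (hz : z ∈ UBall d) :
    Summable fun n => (κ.a (n + 1) : ℂ) • S.ZTadj z ^ n :=
  (S.FTSeries.summable (S.mem_eball_radius hz)).congr fun n => S.FTSeries_apply_const n z

theorem analyticOnNhd_FT : AnalyticOnNhd ℂ S.FT (UBall d) := by
  have h := S.FTSeries.hasFPowerSeriesOnBall (zero_lt_one.trans_le S.one_le_radius_FTSeries)
  rw [FTSeries_sum] at h
  exact h.analyticOnNhd.mono fun z hz => S.mem_eball_radius hz

/-- The values of `Δ j h` are `C F(Z T^*) h`. -/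
theorem Delta_j_apply (h : H) (z : UBall d) :
    HK.Delta κ d S.defectSpace (S.j h) z = S.C' (S.FT z.1 h) := by
  have h1 := hasSum_degree (HK.hasSum_apply (HK.Delta κ d S.defectSpace (S.j h)) z)
  have h2 := ((S.summable_FT z.2).hasSum.mapL (ContinuousLinearMap.apply ℂ H h)).mapL S.C'
  refine h1.unique (h2.congr_fun fun n => ?_)
  change _ = S.C' ((κ.a (n + 1) : ℂ) • (S.ZTadj z.1 ^ n) h)
  -- The degree-n part of Δ j h has coefficients a_{n+1} γ_α C T^{*α} h, which the multinomial
  -- theorem assembles into a_{n+1} C (ZT^*)^n h.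
  rw [ZTadj, sum_smul_pow_eq _ S.commute_adjoint, sum_apply, map_smul, map_sum, Finset.smul_sum]
  refine Finset.sum_congr rfl fun α hα => ?_
  have hn : ∑ i, α i = n := by simpa using hα
  have ha := (κ.a_pos n).ne'
  rw [HK.coeff_Delta, coeff_j, KernelSeq.wt, hn, smul_apply, map_smul, smul_smul, smul_smul,
    smul_smul]
  congr 1
  have ha' : (κ.a n : ℂ) ≠ 0 := by exact_mod_cast ha
  push_cast
  field_simp

end PureKContraction

/-! ### The function W_T and the wandering subspace of M. -/

theorem AnalyticOnNhd.const_add_sum_smul_comp {ι E F G G' : Type*} [Fintype ι]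
    [NormedAddCommGroup E] [NormedSpace ℂ E] [NormedAddCommGroup F] [NormedSpace ℂ F]
    [NormedAddCommGroup G] [NormedSpace ℂ G] [NormedAddCommGroup G'] [NormedSpace ℂ G']
    {f : EuclideanSpace ℂ ι → F →L[ℂ] G} {s : Set (EuclideanSpace ℂ ι)} (hf : AnalyticOnNhd ℂ f s)
    (A : E →L[ℂ] G') (C : G →L[ℂ] G') (B : ι → E →L[ℂ] F) :
    AnalyticOnNhd ℂ (fun z => A + ∑ i, z i • (C ∘L f z ∘L B i)) s := by
  refine analyticOnNhd_const.add (Finset.univ.analyticOnNhd_fun_sum fun i _ => ?_)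
  let Φ : (F →L[ℂ] G) →L[ℂ] (E →L[ℂ] G') := C.postcomp E ∘L (B i).precomp G
  have h : AnalyticOnNhd ℂ (fun z => Φ (f z)) s := Φ.comp_analyticOnNhd hf
  exact ((EuclideanSpace.proj i : EuclideanSpace ℂ ι →L[ℂ] ℂ).analyticOnNhd _).smul h

namespace PureKContraction

variable {κ : KernelSeq} {d : ℕ} {H : Type*} [NormedAddCommGroup H] [InnerProductSpace ℂ H]
  [CompleteSpace H] (S : PureKContraction κ d H)

open ContinuousLinearMap (adjoint adjoint_inner_left adjoint_inner_right)

theorem colMzAdj_apply (f : HK κ d S.defectSpace) (i : Fin d) :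
    S.colMzAdj f i = HK.backShift κ S.defectSpace i f := by
  have h1 : S.colMzAdj f = WithLp.toLp 2 fun i => HK.backShift κ S.defectSpace i f := by
    refine ext_inner_right ℂ fun y => ?_
    rw [colMzAdj, adjoint_inner_left, rowOp_apply, PiLp.inner_apply, inner_sum]
    refine Finset.sum_congr rfl fun k _ => ?_
    rw [← adjoint_inner_left, HK.adjoint_Mz]
  rw [h1]

/-- The column operator `M_z^*` has closed range. -/
theorem isClosed_range_colMzAdj : IsClosed (S.colMzAdj.range :
    Set (PiLp 2 fun _ : Fin d => HK κ d S.defectSpace)) := by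
  let P : PiLp 2 (fun _ : Fin d => HK κ d S.defectSpace) →L[ℂ]
      PiLp 2 (fun _ : Fin d => HK κ d S.defectSpace) :=
    S.colMzAdj ∘L rowOp (HK.Mz κ S.defectSpace) ∘L oplus d (HK.Delta κ d S.defectSpace)
  -- P = M_z^* M_z (⊕Δ) has its values in the range of M_z^* and fixes that range pointwise, so the
  -- range is the fixed-point set of a continuous map.
  have h : (S.colMzAdj.range : Set (PiLp 2 fun _ : Fin d => HK κ d S.defectSpace)) =
      {y | P y = y} := by
    ext y
    constructor
    · rintro ⟨f, rfl⟩
      refine PiLp.ext fun i => ?_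
      change S.colMzAdj (rowOp (HK.Mz κ S.defectSpace)
        (oplus d (HK.Delta κ d S.defectSpace) (S.colMzAdj f))) i = S.colMzAdj f i
      rw [colMzAdj_apply, colMzAdj_apply, rowOp_apply]
      simp only [oplus_apply, colMzAdj_apply]
      exact HK.backShift_sum_Mz_Delta i f
    · intro hy
      exact ⟨_, hy⟩
  rw [h]
  exact isClosed_eq P.continuous continuous_id

theorem isClosed_tildeD : IsClosed (S.tildeD : Set (PiLp 2 (fun _ : Fin d => S.HTilde))) :=
  (Submodule.isClosed_topologicalClosure _).inter <| S.isClosed_range_colMzAdj.preimage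
    (oplus d S.j.toContinuousLinearMap ∘L S.invDefect).continuous

theorem mem_tildeD (y : PiLp 2 fun _ : Fin d => S.HTilde) :
    y ∈ S.tildeD ↔ y ∈ S.defectTilde.range.topologicalClosure ∧
      ∃ f, ∀ i, HK.backShift κ S.defectSpace i f = S.j (S.invDefect y i) := by
  rw [tildeD, Submodule.mem_inf, Submodule.mem_comap]
  refine and_congr_right fun _ => exists_congr fun f => ?_
  rw [PiLp.ext_iff]
  refine forall_congr' fun i => ?_
  rw [← colMzAdj_apply]
  rfl

theorem invDefect_apply (y : PiLp 2 fun _ : Fin d => S.HTilde) (i : Fin d) :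
    S.invDefect y i = S.IT.symm (S.defectTilde y i) := rfl

/-- On Im C this is T̃^* C = D_T̃ T̃^*; continuity extends it to the closure. -/
theorem adjoint_rowTilde_mem_closure {v : H} (hv : v ∈ S.defectSpace) :
    adjoint S.rowTilde v ∈ S.defectTilde.range.topologicalClosure := by
  have h : S.defectSpace ≤
      S.defectTilde.range.topologicalClosure.comap (adjoint S.rowTilde).toLinearMap := by
    refine Submodule.topologicalClosure_minimal _ ?_
      ((Submodule.isClosed_topologicalClosure _).preimage (adjoint S.rowTilde).continuous)
    rintro _ ⟨h, rfl⟩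
    exact Submodule.le_topologicalClosure _
      ⟨adjoint S.rowTilde h, S.defectTilde_adjoint_rowTilde h⟩
  exact h hv

theorem rowTilde_mem_defectSpace {y : PiLp 2 fun _ : Fin d => S.HTilde}
    (hy : y ∈ S.defectTilde.range.topologicalClosure) : S.rowTilde y ∈ S.defectSpace := by
  have h : S.defectTilde.range.topologicalClosure ≤
      S.defectSpace.comap S.rowTilde.toLinearMap := by
    refine Submodule.topologicalClosure_minimal _ ?_
      ((Submodule.isClosed_topologicalClosure _).preimage S.rowTilde.continuous)
    rintro _ ⟨x, rfl⟩
    change S.rowTilde (S.defectTilde x) ∈ S.defectSpace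
    rw [rowTilde_defectTilde]
    exact S.C_mem _
  exact h hy

/-- The restriction of `T̃` to `𝒟̃`, with values in `𝒟`. -/
noncomputable def rowTildeD : S.tildeD →L[ℂ] S.defectSpace :=
  (S.rowTilde ∘L S.tildeD.subtypeL).codRestrict S.defectSpace fun y =>
    S.rowTilde_mem_defectSpace y.2.1

theorem coe_rowTildeD (y : S.tildeD) : (S.rowTildeD y : H) = S.rowTilde y := rfl

/-- The operator `W_T(z)` from `𝒟̃` to `𝒟`. -/
noncomputable def WTD (z : EuclideanSpace ℂ (Fin d)) : S.tildeD →L[ℂ] S.defectSpace :=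
  -S.rowTildeD + S.C' ∘L S.FT z ∘L rowZ H z ∘L S.invDefect ∘L S.tildeD.subtypeL

theorem coe_WTD (z : EuclideanSpace ℂ (Fin d)) (y : S.tildeD) : (S.WTD z y : H) = S.WT z y := rfl

theorem WTD_apply (z : EuclideanSpace ℂ (Fin d)) (y : S.tildeD) :
    S.WTD z y = -S.rowTildeD y + ∑ i, z i • S.C' (S.FT z (S.invDefect y i)) := by
  have h : rowZ H z (S.invDefect y) = ∑ i, z i • S.invDefect y i := by
    rw [rowZ, rowOp_apply]
    rfl
  change -S.rowTildeD y + S.C' (S.FT z (rowZ H z (S.invDefect y))) = _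
  rw [h, map_sum, map_sum]
  simp only [map_smul]

theorem analyticOnNhd_WTD : AnalyticOnNhd ℂ S.WTD (UBall d) := by
  have h : S.WTD = fun z => -S.rowTildeD + ∑ i, z i • (S.C' ∘L S.FT z ∘L
      (PiLp.proj 2 (fun _ : Fin d => H) i ∘L S.invDefect ∘L S.tildeD.subtypeL)) := by
    funext z
    ext1 y
    rw [WTD_apply, add_apply, sum_apply]
    rfl
  rw [h]
  exact S.analyticOnNhd_FT.const_add_sum_smul_comp _ _ _

/-- The linear map `x ↦ W_T x` from `𝒟̃` to `H_K(𝒟)`. -/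
noncomputable def innerMap : S.tildeD →ₗ[ℂ] HK κ d S.defectSpace :=
  (-(RKHS.kerFun (HK κ d S.defectSpace) (HK.origin d) ∘L S.rowTildeD) +
    rowOp (HK.Mz κ S.defectSpace) ∘L oplus d (HK.Delta κ d S.defectSpace) ∘L
      oplus d S.j.toContinuousLinearMap ∘L S.invDefect ∘L S.tildeD.subtypeL).toLinearMap

theorem innerMap_eq (y : S.tildeD) : S.innerMap y = -HK.const κ d (S.rowTildeD y) +
    ∑ i, HK.Mz κ S.defectSpace i (HK.Delta κ d S.defectSpace (S.j (S.invDefect y i))) := by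
  rw [HK.const, ← HK.kerFun_eq]
  exact congrArg (-RKHS.kerFun (HK κ d S.defectSpace) (HK.origin d) (S.rowTildeD y) + ·)
    (rowOp_apply (HK.Mz κ S.defectSpace)
      (oplus d (HK.Delta κ d S.defectSpace) (oplus d S.j.toContinuousLinearMap (S.invDefect y))))

theorem innerMap_apply (y : S.tildeD) (z : UBall d) : S.innerMap y z = S.WTD z y := by
  have h4 : (∑ i, HK.Mz κ S.defectSpace i
      (HK.Delta κ d S.defectSpace (S.j (S.invDefect y i)))) z =
      ∑ i, HK.Mz κ S.defectSpace i (HK.Delta κ d S.defectSpace (S.j (S.invDefect y i))) z := by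
    change RKHS.coeCLM ℂ _ z = _
    rw [map_sum, Finset.sum_apply]
    rfl
  rw [innerMap_eq, RKHS.coe_add, Pi.add_apply, RKHS.coe_neg, Pi.neg_apply, HK.const_apply, h4,
    WTD_apply]
  simp only [HK.Mz_apply, Delta_j_apply]

/-- This is where the range condition defining 𝒟̃ is used: the tuple of the j(I_T⁻¹ D_T̃ y)_i has
the form M_z^* f, so it is fixed by M_z^* M_z (⊕Δ). -/
theorem backShift_innerMap (y : S.tildeD) (i : Fin d) :
    HK.backShift κ S.defectSpace i (S.innerMap y) = S.j (S.invDefect y i) := by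
  obtain ⟨f, hf⟩ := ((S.mem_tildeD y).1 y.2).2
  rw [innerMap_eq, map_add, map_neg, HK.backShift_const, neg_zero, zero_add]
  simp only [← hf]
  exact HK.backShift_sum_Mz_Delta i f

theorem sum_T_DeltaT (y : PiLp 2 fun _ : Fin d => S.HTilde) :
    ∑ i, S.T i (S.DeltaT (S.invDefect y i)) = S.rowTilde (S.defectTilde y) := by
  rw [rowTilde_apply]
  rfl

/-- The two terms of j^* W_T y are -C T̃ y and T̃ D_T̃ y, which cancel because C intertwines with
D_T̃. -/
theorem jAdj_innerMap (y : S.tildeD) : S.jAdj (S.innerMap y) = 0 := by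
  rw [innerMap_eq, map_add, map_neg, jAdj_const, map_sum]
  simp only [jAdj_Mz, ← DeltaT_apply]
  rw [sum_T_DeltaT, rowTilde_defectTilde, coe_rowTildeD, neg_add_cancel]

theorem innerMap_mem_wanderingSubspace (y : S.tildeD) :
    S.innerMap y ∈ wanderingSubspace (HK.Mz κ S.defectSpace) S.M :=
  (S.mem_wanderingSubspace_M _).2
    ⟨S.jAdj_innerMap y, fun i => ⟨_, (S.backShift_innerMap y i).symm⟩⟩

theorem innerMap_origin (y : S.tildeD) : S.innerMap y (HK.origin d) = -S.rowTildeD y := by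
  rw [innerMap_apply, WTD_apply]
  have h : ∑ i, (HK.origin d).1 i • S.C' (S.FT (HK.origin d).1 (S.invDefect y i)) = 0 :=
    Finset.sum_eq_zero fun i _ => zero_smul ℂ _
  rw [h, add_zero]

/-- The value at the origin contributes ‖T̃y‖². Since ⟨Δ j x, j x⟩ = ⟨Δ_T x, x⟩ is the squared norm
of x in H̃, the remaining sum contributes ‖D_T̃ y‖². -/
theorem norm_innerMap (y : S.tildeD) : ‖S.innerMap y‖ = ‖y‖ := by
  refine (sq_eq_sq₀ (norm_nonneg _) (norm_nonneg _)).1 ?_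
  have h : ‖S.defectTilde y‖ ^ 2 = ∑ i, (inner ℂ (HK.Delta κ d S.defectSpace
      (S.j (S.invDefect y i))) (S.j (S.invDefect y i))).re := by
    rw [PiLp.norm_sq_eq_of_L2]
    refine Finset.sum_congr rfl fun i _ => ?_
    rw [← inner_DeltaT, ← tilde_norm_sq]
    rfl
  rw [HK.norm_sq_eq, innerMap_origin, norm_neg]
  simp only [backShift_innerMap]
  rw [← h]
  exact S.norm_sq_rowTilde_add y

theorem exists_innerMap_eq {f : HK κ d S.defectSpace}
    (hf : f ∈ wanderingSubspace (HK.Mz κ S.defectSpace) S.M) : ∃ y, S.innerMap y = f := by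
  obtain ⟨h0, hx⟩ := (S.mem_wanderingSubspace_M f).1 hf
  choose x hx using hx
  set v := f (HK.origin d) with hv
  let x' : PiLp 2 (fun _ : Fin d => S.HTilde) := WithLp.toLp 2 fun i => S.IT (x i)
  have hfx : f = HK.const κ d v +
      ∑ i, HK.Mz κ S.defectSpace i (HK.Delta κ d S.defectSpace (S.j (x i))) := by
    simp only [hx]
    exact HK.eq_const_add_sum f
  have h1 : S.C v + S.rowTilde x' = 0 := by
    have h2 := h0
    rw [hfx, map_add, jAdj_const, map_sum] at h2
    simp only [jAdj_Mz, ← DeltaT_apply] at h2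
    rw [rowTilde_apply]
    exact h2
  -- This y is the adjoint of the isometric column (-T̃, D_T̃) applied to (v, x'). The relation Cv +
  -- T̃x' = 0 places (v, x') in the range of the column, so D_T̃ y = x' and T̃y = -v.
  set y := S.defectTilde x' - adjoint S.rowTilde v with hy
  have hD : S.defectTilde y = x' := by
    rw [hy, map_sub, defectTilde_sq, defectTilde_adjoint_rowTilde, sub_sub, ← map_add, add_comm,
      h1, map_zero, sub_zero]
  have hT : S.rowTilde y = -v := by
    rw [hy, map_sub, rowTilde_defectTilde, rowTilde_adjoint_rowTilde,
      show S.C (S.rowTilde x') - ((v : H) - S.C (S.C v)) =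
        S.C (S.C v) + S.C (S.rowTilde x') - v by abel, ← map_add, h1, map_zero, zero_sub]
  have hinv (i : Fin d) : S.invDefect y i = x i := by
    rw [invDefect_apply, hD]
    exact S.IT.symm_apply_apply (x i)
  have hmem : y ∈ S.tildeD := by
    -- The function f itself witnesses the range condition.
    refine (S.mem_tildeD y).2 ⟨?_, f, fun i => by rw [hinv, hx]⟩
    exact Submodule.sub_mem _ (Submodule.le_topologicalClosure _ ⟨x', rfl⟩)
      (S.adjoint_rowTilde_mem_closure v.2)
  refine ⟨⟨y, hmem⟩, ?_⟩
  have hT' : S.rowTildeD ⟨y, hmem⟩ = -v := Subtype.ext hT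
  rw [innerMap_eq, hT', hfx]
  have h3 : HK.const κ d (-v) = -HK.const κ d v := by
    rw [HK.const, HK.const, ← HK.kerFun_eq, ← HK.kerFun_eq, map_neg]
  rw [h3, neg_neg]
  simp only [hinv]

theorem mem_wanderingSubspace_iff (f : HK κ d S.defectSpace) :
    f ∈ wanderingSubspace (HK.Mz κ S.defectSpace) S.M ↔ ∃ y, S.innerMap y = f :=
  ⟨S.exists_innerMap_eq, by rintro ⟨y, rfl⟩; exact S.innerMap_mem_wanderingSubspace y⟩

/-- The values of the map lie in W(M), which is contained in M and orthogonal to Σ M_{z_i} M; for α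
≠ 0 the operator M_z^α sends M into that sum. -/
theorem isKInner_WTD : IsKInner κ S.WTD := by
  refine ⟨S.analyticOnNhd_WTD, ⟨S.innerMap, S.norm_innerMap⟩, S.innerMap_apply,
    fun α hα x y => ?_⟩
  have hx := S.innerMap_mem_wanderingSubspace x
  have hy := S.innerMap_mem_wanderingSubspace y
  exact Submodule.inner_left_of_mem_orthogonal
    (tuplePow_mem_iSup_map (HK.Mz κ S.defectSpace) S.M S.Mz_mem_M hα hy.1) hx.2

end PureKContraction

theorem mainTheorem4 (κ : KernelSeq) {d : ℕ} {H : Type*} [NormedAddCommGroup H]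
    [InnerProductSpace ℂ H] [CompleteSpace H] (S : PureKContraction κ d H) :
    -- the canonical dilation intertwines, so that `M` is invariant under `M_z`
    (∀ i h, S.j (ContinuousLinearMap.adjoint (S.T i) h) =
      ContinuousLinearMap.adjoint (HK.Mz κ S.defectSpace i) (S.j h)) ∧
    -- `𝒟̃` is a closed subspace of `H̃^d`
    IsClosed (S.tildeD : Set (PiLp 2 (fun _ : Fin d => S.HTilde))) ∧
    -- the series `F(Z T^*)` converges for `z` in the ball
    (∀ z ∈ UBall d, Summable fun n => (κ.a (n + 1) : ℂ) • S.ZTadj z ^ n) ∧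
    ∃ W : EuclideanSpace ℂ (Fin d) → S.tildeD →L[ℂ] S.defectSpace,
      (∀ z ∈ UBall d, ∀ x : S.tildeD, (W z x : H) = S.WT z x) ∧
      -- each `W_T x` belongs to `H_K(𝒟)` and `‖W_T x‖ = ‖x‖`
      (∀ x : S.tildeD, ∃ f : HK κ d S.defectSpace, (∀ z : UBall d, f z = W z x) ∧ ‖f‖ = ‖x‖) ∧
      -- `W(M) = {W_T x ; x ∈ 𝒟̃}`
      (∀ f : HK κ d S.defectSpace, f ∈ wanderingSubspace (HK.Mz κ S.defectSpace) S.M ↔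
        ∃ x : S.tildeD, ∀ z : UBall d, f z = W z x) ∧
      IsKInner κ W := by
  refine ⟨fun i h => ?_, S.isClosed_tildeD, fun z hz => S.summable_FT hz, S.WTD,
    fun z _ x => S.coe_WTD z x, fun x => ⟨S.innerMap x, S.innerMap_apply x, S.norm_innerMap x⟩,
    fun f => ?_, S.isKInner_WTD⟩
  · rw [HK.adjoint_Mz, S.j_adjoint]
  · rw [S.mem_wanderingSubspace_iff]
    refine exists_congr fun x => ⟨?_, fun h => RKHS.ext fun z => ?_⟩
    · rintro rfl z
      exact S.innerMap_apply x z
    · rw [S.innerMap_apply, h]
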